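/- **Setting.** Let $(W,S)$ be a Coxeter system with $S$ finite, $\Bbbk$ an integral domain, and $\mathfrak h=(V,\{\alpha_s^\vee\}_{s\in S},\{\alpha_s\}_{s\in S})$ a realization of $(W,S)$ over $\Bbbk$: $V$ is a free $\Bbbk$-module of finite rank, $\alpha_s^\vee\in V$, $\alpha_s\in V^*$, $\langle\alpha_s^\vee,\alpha_s\rangle=2$, the assignment $s\mapsto(v\mapsto v-\langle\alpha_s,v\rangle\alpha_s^\vee)$ defines a representation of $W$ on $V$, and the two-colored quantum numbers satisfy $[m_{st}]_s=[m_{st}]_t=0$ whenever $s\ne t$ and $m_{st}<\infty$. Assume that $\mathfrak h$ is balanced ($[m_{st}-1]_s=[m_{st}-1]_t=1$ for such $s,t$) and satisfies Demazure surjectivity ($\alpha_s:V\to\Bbbk$ and $\alpha_s^\vee:V^*\to\Bbbk$ are surjective for all $s$). Let $\mathscr D_{\mathrm{BS}}(\mathfrak h,W)$ be the Elias–Williamson diagrammatic category, with objects $B_{\underline w}$ for words $\underline w$ in $S$ and graded morphism modules, and let $\mathscr D^\oplus_{\mathrm{BS}}$ be its additive hull: objects are finite direct sums of $B_{\underline w}(n)$,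 $n\in\mathbb Z$, and $\mathrm{Hom}(B_{\underline w}(n),B_{\underline v}(m))$ is the part of degree $m-n$ of the morphisms $B_{\underline w}\to B_{\underline v}$. A *sequence* is a family $\mathcal F=(\mathcal F^i)_{i\in\mathbb Z}$ of objects of $\mathscr D^\oplus_{\mathrm{BS}}$ almost all of which are zero. For sequences $\mathcal F,\mathcal G$ let $\underline{\mathrm{Hom}}_{\mathsf{BE}}(\mathcal F,\mathcal G)$ be the bigraded $\Bbbk$-module with $$\underline{\mathrm{Hom}}_{\mathsf{BE}}(\mathcal F,\mathcal G)^i_j=\prod_{q-p=i-j}\mathrm{Hom}(\mathcal F^p,\mathcal G^q(j)),$$ with the evident composition $g\circ f=g(j)\bullet f$ for $f:\mathcal F^p\to\mathcal G^q(j)$; an element $r\in V^*$ acts on it with bidegree $(2,2)$ by $f\mapsto r\star f$, i.e. by placing a box labelled $r$ to the left. Let $\Lambda$ be the exterior algebra of $V^*$, with $V^*$ in bidegree $(1,2)$, and put $\underline{\mathrm{Hom}}_{\mathsf{LM}}(\mathcal F,\mathcal G)=\Lambda\otimes_\Bbbk\underline{\mathrm{Hom}}_{\mathsf{BE}}(\mathcal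 F,\mathcal G)$, with composition $(r\otimes f)\circ(s\otimes g)=(-1)^{|f||s|}(r\wedge s)\otimes(f\circ g)$, where $|\cdot|$ is the first (cohomological) degree. Let $$\kappa((r_1\wedge\cdots\wedge r_n)\otimes f)=\sum_{i}(-1)^{i+1}(r_1\wedge\cdots\widehat{r_i}\cdots\wedge r_n)\otimes(r_i\star f),$$ and, for $x\in V$, let $$x\frown((r_1\wedge\cdots\wedge r_n)\otimes f)=\sum_i(-1)^{i+1}r_i(x)\,(r_1\wedge\cdots\widehat{r_i}\cdots\wedge r_n)\otimes f .$$ A *left-monodromic complex* is a pair $(\mathcal F,\delta_{\mathcal F})$ of a sequence $\mathcal F$ and an element $\delta_{\mathcal F}\in\underline{\mathrm{Hom}}_{\mathsf{LM}}(\mathcal F,\mathcal F)^1_0$ with $\delta_{\mathcal F}\circ\delta_{\mathcal F}+\kappa(\delta_{\mathcal F})=0$. For two of them, $\underline{\mathrm{Hom}}_{\mathsf{LM}}(\mathcal F,\mathcal G)$ carries the differential $d(f)=\kappa(f)+\delta_{\mathcal G}\circ f+(-1)^{|f|+1}f\circ\delta_{\mathcal F}$; let $\mathrm{gHom}_{\mathsf{LM}}(\mathcal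 F,\mathcal G)$ be its bigraded cohomology, with the induced composition, and $\mathrm{gEnd}_{\mathsf{LM}}(\mathcal F)=\mathrm{gHom}_{\mathsf{LM}}(\mathcal F,\mathcal F)$. Let $R^\vee=\mathrm{Sym}(V)$, with $V$ in bidegree $(0,-2)$. **Theorem.** (1) For every left-monodromic complex $\mathcal F$ and every $x\in V$, $x\frown\delta_{\mathcal F}$ is a cocycle, and there is a unique $\Bbbk$-algebra homomorphism $\mu_{\mathcal F}:R^\vee\to\mathrm{gEnd}_{\mathsf{LM}}(\mathcal F)$ such that $\mu_{\mathcal F}(x)$ is the class of $x\frown\delta_{\mathcal F}$ for all $x\in V$. It is bigraded: it maps $\mathrm{Sym}^n(V)$ to bidegree $(0,-2n)$. (2) For all left-monodromic complexes $\mathcal F,\mathcal G$, the formula $$y\mathbin{\widehat\star}f=\mu_{\mathcal G}(y)\circ f=f\circ\mu_{\mathcal F}(y)\qquad(y\in R^\vee,\ f\in\mathrm{gHom}_{\mathsf{LM}}(\mathcal F,\mathcal G))$$ holds (the two right-hand sides agree) and makes $\mathrm{gHom}_{\mathsf{LM}}(\mathcal F,\mathcal G)$ a bigraded left $R^\vee$-module.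 (3) For all $f\in\mathrm{gHom}_{\mathsf{LM}}(\mathcal F,\mathcal G)$, $g\in\mathrm{gHom}_{\mathsf{LM}}(\mathcal G,\mathcal H)$ and $y\in R^\vee$, $$y\mathbin{\widehat\star}(g\circ f)=(y\mathbin{\widehat\star}g)\circ f=g\circ(y\mathbin{\widehat\star}f).$$ -/

import Mathlib

open scoped TensorProduct DirectSum

set_option linter.unusedSectionVars false

noncomputable section

namespace LeftMonodromy

/-! ## Realizations of Coxeter systems -/

/-- The part of polynomial degree `n` of a symmetric algebra. -/
def symDeg (k N : Type*) [CommRing k] [AddCommGroup N] [Module k N] (n : ℕ) :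
    Submodule k (SymmetricAlgebra k N) :=
  LinearMap.range (SymmetricAlgebra.ι k N) ^ n

/-- The `2`-colored quantum number `[n]_x` evaluated at `x, y`
(the number `[n]_y` is `qnum y x n`). -/
def qnum {k : Type*} [CommRing k] (x y : k) : ℕ → k
  | 0 => 0
  | 1 => 1
  | n + 2 => (if Even n then x else y) * qnum x y (n + 1) - qnum x y n

/-- A balanced realization, satisfying Demazure surjectivity, of the Coxeter system `cs`.
Conditions indexed by an ordered pair `(s, t)` are imposed for `(t, s)` as well, so that
`quantum_zero` and `balanced` contain the conditions on both `[n]_s` and `[n]_t`.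
The entry `M s t = 0` means that `st` has infinite order. -/
structure Realization {B W : Type*} [Group W] {M : CoxeterMatrix B} (cs : CoxeterSystem M W)
    (k V : Type*) [CommRing k] [AddCommGroup V] [Module k V] where
  coroot : B → V
  root : B → Module.Dual k V
  root_coroot : ∀ s, root s (coroot s) = 2
  exists_rep : ∃ ρ : Representation k W V,
    ∀ s v, ρ (cs.simple s) v = v - root s v • coroot s
  quantum_zero : ∀ s t, s ≠ t → M s t ≠ 0 →
    qnum (-root t (coroot s)) (-root s (coroot t)) (M s t) = 0
  balanced : ∀ s t, s ≠ t → M s t ≠ 0 →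
    qnum (-root t (coroot s)) (-root s (coroot t)) (M s t - 1) = 1
  root_surjective : ∀ s, Function.Surjective (root s)
  coroot_surjective : ∀ s, Function.Surjective (fun r : Module.Dual k V => r (coroot s))

variable {B W : Type*} [Group W] {M : CoxeterMatrix B} {cs : CoxeterSystem M W}
variable {k V : Type*} [CommRing k] [AddCommGroup V] [Module k V]

namespace Realization

/-- The action of the simple reflection `s` on `V^*`. -/
def reflDual (𝔥 : Realization cs k V) (s : B) : Module.Dual k V →ₗ[k] Module.Dual k V :=
  LinearMap.id - (Module.Dual.eval k V (𝔥.coroot s)).smulRight (𝔥.root s)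

/-- The action of the simple reflection `s` on `S(V^*)`. -/
def reflSym (𝔥 : Realization cs k V) (s : B) :
    SymmetricAlgebra k (Module.Dual k V) →ₐ[k] SymmetricAlgebra k (Module.Dual k V) :=
  SymmetricAlgebra.lift (SymmetricAlgebra.ι k (Module.Dual k V) ∘ₗ 𝔥.reflDual s)

/-- The simple root `α_s` as an element of `S(V^*)`. -/
def rootSym (𝔥 : Realization cs k V) (s : B) : SymmetricAlgebra k (Module.Dual k V) :=
  SymmetricAlgebra.ι k (Module.Dual k V) (𝔥.root s)

theorem reflDual_reflDual (𝔥 : Realization cs k V) (s : B) (r : Module.Dual k V) :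
    𝔥.reflDual s (𝔥.reflDual s r) = r := by
  simp only [reflDual, LinearMap.sub_apply, LinearMap.id_apply, LinearMap.smulRight_apply,
    Module.Dual.eval_apply, LinearMap.smul_apply, 𝔥.root_coroot, smul_eq_mul]
  module

theorem reflSym_injective (𝔥 : Realization cs k V) (s : B) :
    Function.Injective (𝔥.reflSym s).toRingHom := by
  have h : (𝔥.reflSym s).comp (𝔥.reflSym s) = AlgHom.id k _ := by
    apply SymmetricAlgebra.algHom_ext
    ext r
    simp [reflSym, reflDual_reflDual]
  exact Function.LeftInverse.injective (g := 𝔥.reflSym s) fun x => DFunLike.congr_fun h x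

end Realization

/-! ## Diagrams -/

/-- The alternating word `(s, t, s, …)` of length `n`. -/
def alt (s t : B) : ℕ → List B
  | 0 => []
  | n + 1 => s :: alt t s n

/-- The letter of index `n` (counted from `0`) of the infinite word `(s, t, s, …)`. -/
def altLetter (s t : B) : ℕ → B
  | 0 => s
  | n + 1 => altLetter t s n

theorem alt_append (s t : B) (n : ℕ) : alt s t n ++ [altLetter s t n] = alt s t (n + 1) := by
  induction n generalizing s t with
  | zero => rfl
  | succ n ih => simp only [alt, altLetter, List.cons_append, ih]

theorem alt_append_append (s t : B) (n : ℕ) (l : List B) :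
    alt s t n ++ (altLetter s t n :: l) = alt s t (n + 1) ++ l := by
  rw [← alt_append, List.append_assoc, List.singleton_append]

/-- Formal `k`-linear combinations of Elias–Williamson diagrams, before imposing any relation:
`Diag 𝔥 w v d` consists of the formal expressions of degree `d` from `B_w` (bottom) to `B_v`
(top).  The equations between words and degrees which appear as arguments of `comp` and `tensor`
make casts unnecessary. -/
inductive Diag (𝔥 : Realization cs k V) : List B → List B → ℤ → Type _
  | id (w : List B) : Diag 𝔥 w w 0
  | box (n : ℕ) (f : SymmetricAlgebra k (Module.Dual k V))
      (hf : f ∈ symDeg k (Module.Dual k V) n) {d : ℤ} (hd : d = 2 * n) : Diag 𝔥 [] [] d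
  | endDot (s : B) : Diag 𝔥 [s] [] 1
  | startDot (s : B) : Diag 𝔥 [] [s] 1
  | split (s : B) : Diag 𝔥 [s] [s, s] (-1)
  | merge (s : B) : Diag 𝔥 [s, s] [s] (-1)
  | vertex (s t : B) (hst : s ≠ t) {m : ℕ} (hm : M s t = m) (hm0 : m ≠ 0) :
      Diag 𝔥 (alt s t m) (alt t s m) 0
  | comp {w v u : List B} {d e n : ℤ} (g : Diag 𝔥 v u e) (f : Diag 𝔥 w v d) (hn : e + d = n) :
      Diag 𝔥 w u n
  | tensor {w v w' v' x y : List B} {d d' n : ℤ} (f : Diag 𝔥 w v d) (f' : Diag 𝔥 w' v' d')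
      (hx : w ++ w' = x) (hy : v ++ v' = y) (hn : d + d' = n) : Diag 𝔥 x y n
  | zero (w v : List B) (d : ℤ) : Diag 𝔥 w v d
  | add {w v : List B} {d : ℤ} (f g : Diag 𝔥 w v d) : Diag 𝔥 w v d
  | smul {w v : List B} {d : ℤ} (c : k) (f : Diag 𝔥 w v d) : Diag 𝔥 w v d

namespace Diag

variable {𝔥 : Realization cs k V}

/-- The cap `B_{(s,s)} → B_∅`. -/
def cap (𝔥 : Realization cs k V) (s : B) : Diag 𝔥 [s, s] [] 0 :=
  comp (endDot s) (merge s) (by norm_num)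

/-- The cup `B_∅ → B_{(s,s)}`. -/
def cup (𝔥 : Realization cs k V) (s : B) : Diag 𝔥 [] [s, s] 0 :=
  comp (split s) (startDot s) (by norm_num)

end Diag

/-! ## Jones–Wenzl projectors

`JW_w`, for the alternating word `w = (s, t, …)` of length `m`, is the image in `End(B_w)` of the
Jones–Wenzl projector of the `2`-colored Temperley–Lieb algebra on `m - 1` strands, i.e. of the
unique element with constant term `1` that is annihilated by all the generators `u_i`. The
generator `u_i` acts on the letters of index `i, i+1, i+2`. -/

/-- Defining relations of the `2`-colored Temperley–Lieb algebra attached to the alternating word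
`(s, t, …)` of length `n + 2`. -/
inductive TLRel (𝔥 : Realization cs k V) (s t : B) (n : ℕ) :
    FreeAlgebra k (Fin n) → FreeAlgebra k (Fin n) → Prop
  | sq (i : Fin n) : TLRel 𝔥 s t n (FreeAlgebra.ι k i * FreeAlgebra.ι k i)
      (𝔥.root (altLetter s t (i + 1)) (𝔥.coroot (altLetter s t i)) • FreeAlgebra.ι k i)
  | braid (i j : Fin n) (h : (i : ℕ) + 1 = j ∨ (j : ℕ) + 1 = i) :
      TLRel 𝔥 s t n (FreeAlgebra.ι k i * FreeAlgebra.ι k j * FreeAlgebra.ι k i) (FreeAlgebra.ι k i)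
  | far (i j : Fin n) (h : (i : ℕ) + 1 < j) :
      TLRel 𝔥 s t n (FreeAlgebra.ι k i * FreeAlgebra.ι k j)
        (FreeAlgebra.ι k j * FreeAlgebra.ι k i)

/-- The element of the free algebra described by a list of coefficients and words. -/
def freeSum (k : Type*) [CommRing k] {n : ℕ} (l : List (k × List (Fin n))) :
    FreeAlgebra k (Fin n) :=
  (l.map fun c => c.1 • (c.2.map (FreeAlgebra.ι k)).prod).sum

/-- `l` represents the Jones–Wenzl projector attached to the alternating word `(s, t, …)` of
length `n + 2`. -/
def IsJonesWenzl (𝔥 : Realization cs k V) (s t : B) (n : ℕ) (l : List (k × List (Fin n))) : Prop :=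
  FreeAlgebra.lift k (fun _ : Fin n => (0 : k)) (freeSum k l) = 1 ∧
  ∀ i : Fin n, RingQuot.mkAlgHom k (TLRel 𝔥 s t n) (FreeAlgebra.ι k i * freeSum k l) = 0

namespace Diag

variable {𝔥 : Realization cs k V}

/-- The image of the Temperley–Lieb generator `u_0` in `End(B_{(s,t,s)})`. -/
def tlCore (𝔥 : Realization cs k V) (s t : B) : Diag 𝔥 [s, t, s] [s, t, s] 0 :=
  comp
    (comp (tensor (tensor (id [s]) (startDot t) rfl rfl rfl) (id [s]) rfl rfl rfl)
      (split s) (n := 0) (by norm_num) : Diag 𝔥 [s] [s, t, s] 0)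
    (comp (merge s)
      (tensor (tensor (id [s]) (endDot t) rfl rfl rfl) (id [s]) rfl rfl rfl)
      (n := 0) (by norm_num) : Diag 𝔥 [s, t, s] [s] 0)
    (by norm_num)

/-- The image of the Temperley–Lieb generator `u_i` in `End(B_{(s,t,…)})`. -/
def tlGen (𝔥 : Realization cs k V) : (s t : B) → (m i : ℕ) → Diag 𝔥 (alt s t m) (alt s t m) 0
  | s, t, m + 3, 0 => tensor (tlCore 𝔥 s t) (id (alt t s m)) rfl rfl (by norm_num)
  | s, t, m + 1, i + 1 => tensor (id [s]) (tlGen 𝔥 t s m i) rfl rfl (by norm_num)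
  | s, t, m, _ => zero (alt s t m) (alt s t m) 0

/-- The image of a product of Temperley–Lieb generators. -/
def tlWord (𝔥 : Realization cs k V) (s t : B) (m : ℕ) {n : ℕ} :
    List (Fin n) → Diag 𝔥 (alt s t m) (alt s t m) 0
  | [] => id (alt s t m)
  | i :: l => comp (tlGen 𝔥 s t m i) (tlWord 𝔥 s t m l) (by norm_num)

/-- The image of a linear combination of products of Temperley–Lieb generators. -/
def tlSum (𝔥 : Realization cs k V) (s t : B) (m : ℕ) {n : ℕ} :
    List (k × List (Fin n)) → Diag 𝔥 (alt s t m) (alt s t m) 0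
  | [] => zero _ _ 0
  | c :: l => add (smul c.1 (tlWord 𝔥 s t m c.2)) (tlSum 𝔥 s t m l)

end Diag

/-! ## Localization and rex moves

Over the fraction field `Q` of `S(V^*)`, the object `B_w` becomes a direct sum of standard objects
indexed by the subexpressions of `w`, and a morphism becomes a matrix with entries in `Q`.
A subexpression is encoded as a list of booleans. -/

section Localization

variable [IsDomain k] [Module.Free k V] [Module.Finite k V]

/-- The fraction field of `S(V^*)`. -/
abbrev FracR (k V : Type*) [CommRing k] [AddCommGroup V] [Module k V] : Type _ :=
  FractionRing (SymmetricAlgebra k (Module.Dual k V))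

/-- The action of the simple reflection `s` on the fraction field of `S(V^*)`. -/
def Realization.reflFrac (𝔥 : Realization cs k V) (s : B) : FracR k V →+* FracR k V :=
  IsFractionRing.map (𝔥.reflSym_injective s)

/-- The action of the element expressed by a word. -/
def Realization.wordFrac (𝔥 : Realization cs k V) : List B → FracR k V →+* FracR k V
  | [] => RingHom.id _
  | s :: w => (𝔥.reflFrac s).comp (Realization.wordFrac 𝔥 w)

/-- The simple root `α_s` in the fraction field. -/
def Realization.rootFrac (𝔥 : Realization cs k V) (s : B) : FracR k V :=
  algebraMap _ _ (𝔥.rootSym s)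

/-- The subword of `w` selected by `e`. -/
def subword (w : List B) (e : List Bool) : List B :=
  ((w.zip e).filter Prod.snd).map Prod.fst

/-- All lists of booleans of length `n`. -/
def allBools : ℕ → List (List Bool)
  | 0 => [[]]
  | n + 1 => (allBools n).map (List.cons false) ++ (allBools n).map (List.cons true)

/-- The product over the positions `i` of the word `(s_1, …, s_r)` of the roots
`s_1 ⋯ s_{i-1} (α_{s_i})`. -/
def Realization.rootProd (𝔥 : Realization cs k V) : List B → FracR k V
  | [] => 1
  | s :: x => 𝔥.rootFrac s * 𝔥.reflFrac s (Realization.rootProd 𝔥 x)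

/-- The product over the positions `i` of the word `(s_1, …, s_r)` of the roots
`s_1^{e_1} ⋯ s_i^{e_i} (α_{s_i})`. -/
def Realization.subRootProd (𝔥 : Realization cs k V) : List B → List Bool → FracR k V
  | s :: x, true :: e => 𝔥.reflFrac s (𝔥.rootFrac s * Realization.subRootProd 𝔥 x e)
  | s :: x, false :: e => 𝔥.rootFrac s * Realization.subRootProd 𝔥 x e
  | _, _ => 1

open Classical in
/-- The matrix of a diagram after localization: `loc f e h` is the entry from the summand of the
source indexed by the subexpression `e` to the summand of the target indexed by `h`. -/
def loc (𝔥 : Realization cs k V) : {w v : List B} → {d : ℤ} → Diag 𝔥 w v d →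
    List Bool → List Bool → FracR k V
  | _, _, _, .id _, e, h => if e = h then 1 else 0
  | _, _, _, .box _ f _ _, _, _ => algebraMap _ _ f
  | _, _, _, .endDot _, e, _ => if e = [false] then 1 else 0
  | _, _, _, .startDot s, _, h => if h = [false] then 𝔥.rootFrac s else 0
  | _, _, _, .split _, e, h =>
      if e = [false] ∧ (h = [false, false] ∨ h = [true, true]) ∨
        e = [true] ∧ (h = [false, true] ∨ h = [true, false]) then 1 else 0
  | _, _, _, .merge s, e, h =>
      if e = [false, false] ∧ h = [false] ∨ e = [false, true] ∧ h = [true] then (𝔥.rootFrac s)⁻¹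
      else if e = [true, true] ∧ h = [false] ∨ e = [true, false] ∧ h = [true] then
        -(𝔥.rootFrac s)⁻¹
      else 0
  | _, _, _, .vertex s t _ (m := m) _ _, e, h =>
      if cs.wordProd (subword (alt s t m) e) = cs.wordProd (subword (alt t s m) h) then
        𝔥.wordFrac (subword (alt s t m) e) (𝔥.rootProd (alt s t m)) /
          𝔥.subRootProd (alt s t m) e
      else 0
  | _, _, _, .comp (v := v) g f _, e, h =>
      ((allBools v.length).map fun c => loc 𝔥 f e c * loc 𝔥 g c h).sum
  | _, _, _, .tensor (w := w) (v := v) f f' _ _ _, e, h =>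
      loc 𝔥 f (e.take w.length) (h.take v.length) *
        𝔥.wordFrac (subword w (e.take w.length))
          (loc 𝔥 f' (e.drop w.length) (h.drop v.length))
  | _, _, _, .zero _ _ _, _, _ => 0
  | _, _, _, .add f g, e, h => loc 𝔥 f e h + loc 𝔥 g e h
  | _, _, _, .smul c f, e, h => algebraMap k _ c * loc 𝔥 f e h

end Localization

/-- Rex moves: composites of braid moves, i.e. of `2m`-valent vertices with vertical strands on
the left and on the right. -/
inductive IsRexMove {𝔥 : Realization cs k V} : {x y : List B} → Diag 𝔥 x y 0 → Prop
  | id (x : List B) : IsRexMove (Diag.id x)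
  | step {x z y a b : List B} {s t : B} {m : ℕ} (hst : s ≠ t) (hm : M s t = m) (hm0 : m ≠ 0)
      (hz : a ++ alt s t m ++ b = z) (hy : a ++ alt t s m ++ b = y)
      (f : Diag 𝔥 x z 0) (hf : IsRexMove f) :
      IsRexMove (Diag.comp
        (Diag.tensor (Diag.tensor (Diag.id a) (Diag.vertex s t hst hm hm0) rfl rfl rfl)
          (Diag.id b) hz hy rfl) f (by norm_num))

/-- Lower terms: linear combinations of diagrams which factor through an object `B_z` with `z` of
length smaller than `n`. -/
inductive IsLower {𝔥 : Realization cs k V} (n : ℕ) :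
    {x y : List B} → {d : ℤ} → Diag 𝔥 x y d → Prop
  | zero (x y : List B) (d : ℤ) : IsLower n (Diag.zero x y d)
  | add {x y : List B} {d : ℤ} (f g : Diag 𝔥 x y d) (hf : IsLower n f) (hg : IsLower n g) :
      IsLower n (Diag.add f g)
  | smul {x y : List B} {d : ℤ} (c : k) (f : Diag 𝔥 x y d) (hf : IsLower n f) :
      IsLower n (Diag.smul c f)
  | factor {x z y : List B} {d e d' : ℤ} (g : Diag 𝔥 z y e) (f : Diag 𝔥 x z d) (hd : e + d = d')
      (hz : z.length < n) : IsLower n (Diag.comp g f hd)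

/-- `x` is a reduced expression of the longest element of the standard parabolic subgroup
generated by the (finitely many) simple reflections in `J`, this subgroup being finite. -/
def IsLongestExpr (cs : CoxeterSystem M W) (J : Set B) (x : List B) : Prop :=
  (∀ s ∈ x, s ∈ J) ∧ cs.IsReduced x ∧
  (Subgroup.closure (cs.simple '' J) : Set W).Finite ∧
  ∀ w ∈ Subgroup.closure (cs.simple '' J), cs.length w ≤ x.length

/-! ## The relations -/

section Relations

variable [IsDomain k] [Module.Free k V] [Module.Finite k V]

open Diag in
/-- The congruence on formal diagrams which defines the morphisms of `D_BS(𝔥, W)`. -/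
inductive Rel (𝔥 : Realization cs k V) :
    {w v : List B} → {d : ℤ} → Diag 𝔥 w v d → Diag 𝔥 w v d → Prop
  -- equivalence relation, compatible with all operations
  | refl {w v : List B} {d : ℤ} (f : Diag 𝔥 w v d) : Rel 𝔥 f f
  | symm {w v : List B} {d : ℤ} {f g : Diag 𝔥 w v d} : Rel 𝔥 f g → Rel 𝔥 g f
  | trans {w v : List B} {d : ℤ} {f g h : Diag 𝔥 w v d} : Rel 𝔥 f g → Rel 𝔥 g h → Rel 𝔥 f h
  | add_congr {w v : List B} {d : ℤ} {f f' g g' : Diag 𝔥 w v d} :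
      Rel 𝔥 f f' → Rel 𝔥 g g' → Rel 𝔥 (add f g) (add f' g')
  | smul_congr {w v : List B} {d : ℤ} (c : k) {f f' : Diag 𝔥 w v d} :
      Rel 𝔥 f f' → Rel 𝔥 (smul c f) (smul c f')
  | comp_congr {w v u : List B} {d e n : ℤ} {g g' : Diag 𝔥 v u e} {f f' : Diag 𝔥 w v d}
      (hn : e + d = n) : Rel 𝔥 g g' → Rel 𝔥 f f' → Rel 𝔥 (comp g f hn) (comp g' f' hn)
  | tensor_congr {w v w' v' x y : List B} {d d' n : ℤ} {f g : Diag 𝔥 w v d}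
      {f' g' : Diag 𝔥 w' v' d'} (hx : w ++ w' = x) (hy : v ++ v' = y) (hn : d + d' = n) :
      Rel 𝔥 f g → Rel 𝔥 f' g' → Rel 𝔥 (tensor f f' hx hy hn) (tensor g g' hx hy hn)
  -- `k`-modules
  | add_assoc {w v : List B} {d : ℤ} (f g h : Diag 𝔥 w v d) :
      Rel 𝔥 (add (add f g) h) (add f (add g h))
  | add_comm {w v : List B} {d : ℤ} (f g : Diag 𝔥 w v d) : Rel 𝔥 (add f g) (add g f)
  | zero_add {w v : List B} {d : ℤ} (f : Diag 𝔥 w v d) : Rel 𝔥 (add (zero w v d) f) f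
  | one_smul {w v : List B} {d : ℤ} (f : Diag 𝔥 w v d) : Rel 𝔥 (smul 1 f) f
  | zero_smul {w v : List B} {d : ℤ} (f : Diag 𝔥 w v d) : Rel 𝔥 (smul 0 f) (zero w v d)
  | mul_smul {w v : List B} {d : ℤ} (a b : k) (f : Diag 𝔥 w v d) :
      Rel 𝔥 (smul (a * b) f) (smul a (smul b f))
  | add_smul {w v : List B} {d : ℤ} (a b : k) (f : Diag 𝔥 w v d) :
      Rel 𝔥 (smul (a + b) f) (add (smul a f) (smul b f))
  | smul_add {w v : List B} {d : ℤ} (a : k) (f g : Diag 𝔥 w v d) :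
      Rel 𝔥 (smul a (add f g)) (add (smul a f) (smul a g))
  -- bilinearity of vertical and horizontal concatenation
  | comp_add {w v u : List B} {d e n : ℤ} (g : Diag 𝔥 v u e) (f f' : Diag 𝔥 w v d)
      (hn : e + d = n) : Rel 𝔥 (comp g (add f f') hn) (add (comp g f hn) (comp g f' hn))
  | comp_smul {w v u : List B} {d e n : ℤ} (c : k) (g : Diag 𝔥 v u e) (f : Diag 𝔥 w v d)
      (hn : e + d = n) : Rel 𝔥 (comp g (smul c f) hn) (smul c (comp g f hn))
  | add_comp {w v u : List B} {d e n : ℤ} (g g' : Diag 𝔥 v u e) (f : Diag 𝔥 w v d)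
      (hn : e + d = n) : Rel 𝔥 (comp (add g g') f hn) (add (comp g f hn) (comp g' f hn))
  | smul_comp {w v u : List B} {d e n : ℤ} (c : k) (g : Diag 𝔥 v u e) (f : Diag 𝔥 w v d)
      (hn : e + d = n) : Rel 𝔥 (comp (smul c g) f hn) (smul c (comp g f hn))
  | tensor_add {w v w' v' x y : List B} {d d' n : ℤ} (f : Diag 𝔥 w v d)
      (f' g' : Diag 𝔥 w' v' d') (hx : w ++ w' = x) (hy : v ++ v' = y) (hn : d + d' = n) :
      Rel 𝔥 (tensor f (add f' g') hx hy hn) (add (tensor f f' hx hy hn) (tensor f g' hx hy hn))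
  | tensor_smul {w v w' v' x y : List B} {d d' n : ℤ} (c : k) (f : Diag 𝔥 w v d)
      (f' : Diag 𝔥 w' v' d') (hx : w ++ w' = x) (hy : v ++ v' = y) (hn : d + d' = n) :
      Rel 𝔥 (tensor f (smul c f') hx hy hn) (smul c (tensor f f' hx hy hn))
  | add_tensor {w v w' v' x y : List B} {d d' n : ℤ} (f g : Diag 𝔥 w v d)
      (f' : Diag 𝔥 w' v' d') (hx : w ++ w' = x) (hy : v ++ v' = y) (hn : d + d' = n) :
      Rel 𝔥 (tensor (add f g) f' hx hy hn) (add (tensor f f' hx hy hn) (tensor g f' hx hy hn))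
  | smul_tensor {w v w' v' x y : List B} {d d' n : ℤ} (c : k) (f : Diag 𝔥 w v d)
      (f' : Diag 𝔥 w' v' d') (hx : w ++ w' = x) (hy : v ++ v' = y) (hn : d + d' = n) :
      Rel 𝔥 (tensor (smul c f) f' hx hy hn) (smul c (tensor f f' hx hy hn))
  -- strict monoidal category
  | id_comp {w v : List B} {d : ℤ} (f : Diag 𝔥 w v d) :
      Rel 𝔥 (comp (id v) f (_root_.zero_add d)) f
  | comp_id {w v : List B} {d : ℤ} (f : Diag 𝔥 w v d) :
      Rel 𝔥 (comp f (id w) (_root_.add_zero d)) f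
  | comp_assoc {w v u x : List B} {d e c p q n : ℤ} (h : Diag 𝔥 u x c) (g : Diag 𝔥 v u e)
      (f : Diag 𝔥 w v d) (hp : c + e = p) (hq : e + d = q) (hn : p + d = n) (hn' : c + q = n) :
      Rel 𝔥 (comp (comp h g hp) f hn) (comp h (comp g f hq) hn')
  | tensor_id (w v : List B) : Rel 𝔥 (tensor (id w) (id v) rfl rfl rfl) (id (w ++ v))
  | interchange {w v u w' v' u' x y z : List B} {d e d' e' p p' q q' n : ℤ} (g : Diag 𝔥 v u e)
      (f : Diag 𝔥 w v d) (g' : Diag 𝔥 v' u' e') (f' : Diag 𝔥 w' v' d') (hx : w ++ w' = x)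
      (hy : v ++ v' = y) (hz : u ++ u' = z) (hp : e + d = p) (hp' : e' + d' = p')
      (hq : e + e' = q) (hq' : d + d' = q') (hn : p + p' = n) (hn' : q + q' = n) :
      Rel 𝔥 (tensor (comp g f hp) (comp g' f' hp') hx hz hn)
        (comp (tensor g g' hy hz hq) (tensor f f' hx hy hq') hn')
  | tensor_assoc {w v w' v' w'' v'' x y x' y' z t : List B} {d d' d'' p q n : ℤ}
      (f : Diag 𝔥 w v d) (f' : Diag 𝔥 w' v' d') (f'' : Diag 𝔥 w'' v'' d'')
      (hx : w ++ w' = x) (hy : v ++ v' = y) (hx' : w' ++ w'' = x') (hy' : v' ++ v'' = y')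
      (hz : x ++ w'' = z) (ht : y ++ v'' = t) (hz' : w ++ x' = z) (ht' : v ++ y' = t)
      (hp : d + d' = p) (hq : d' + d'' = q) (hn : p + d'' = n) (hn' : d + q = n) :
      Rel 𝔥 (tensor (tensor f f' hx hy hp) f'' hz ht hn)
        (tensor f (tensor f' f'' hx' hy' hq) hz' ht' hn')
  | nil_tensor {w v : List B} {d : ℤ} (f : Diag 𝔥 w v d) :
      Rel 𝔥 (tensor (id []) f rfl rfl (_root_.zero_add d)) f
  | tensor_nil {w v : List B} {d : ℤ} (f : Diag 𝔥 w v d) :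
      Rel 𝔥 (tensor f (id []) (List.append_nil w) (List.append_nil v) (_root_.add_zero d)) f
  -- boxes add and multiply in the obvious way
  | box_add {n : ℕ} {f g : SymmetricAlgebra k (Module.Dual k V)}
      (hf : f ∈ symDeg k (Module.Dual k V) n) (hg : g ∈ symDeg k (Module.Dual k V) n)
      (hfg : f + g ∈ symDeg k (Module.Dual k V) n) {d : ℤ} (hd : d = 2 * n) :
      Rel 𝔥 (box n (f + g) hfg hd) (add (box n f hf hd) (box n g hg hd))
  | box_smul {n : ℕ} (c : k) {f : SymmetricAlgebra k (Module.Dual k V)}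
      (hf : f ∈ symDeg k (Module.Dual k V) n) (hcf : c • f ∈ symDeg k (Module.Dual k V) n)
      {d : ℤ} (hd : d = 2 * n) :
      Rel 𝔥 (box n (c • f) hcf hd) (smul c (box n f hf hd))
  | box_mul {n m p : ℕ} {f g : SymmetricAlgebra k (Module.Dual k V)}
      (hf : f ∈ symDeg k (Module.Dual k V) n) (hg : g ∈ symDeg k (Module.Dual k V) m)
      (hfg : f * g ∈ symDeg k (Module.Dual k V) p) {d e c : ℤ} (hd : d = 2 * n) (he : e = 2 * m)
      (hc : c = 2 * p) (hdec : d + e = c) :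
      Rel 𝔥 (box p (f * g) hfg hc) (comp (box n f hf hd) (box m g hg he) hdec)
  | box_one (h1 : 1 ∈ symDeg k (Module.Dual k V) 0) (hd : (0 : ℤ) = 2 * (0 : ℕ)) :
      Rel 𝔥 (box 0 1 h1 hd) (id [])
  -- Frobenius unit (with the dot on either side)
  | split_endDot_right (s : B) :
      Rel 𝔥 (comp (tensor (id [s]) (endDot s) rfl rfl rfl) (split s) (by norm_num)) (id [s])
  | split_endDot_left (s : B) :
      Rel 𝔥 (comp (tensor (endDot s) (id [s]) rfl rfl rfl) (split s) (by norm_num)) (id [s])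
  | merge_startDot_right (s : B) :
      Rel 𝔥 (comp (merge s) (tensor (id [s]) (startDot s) rfl rfl rfl) (by norm_num)) (id [s])
  | merge_startDot_left (s : B) :
      Rel 𝔥 (comp (merge s) (tensor (startDot s) (id [s]) rfl rfl rfl) (by norm_num)) (id [s])
  -- Frobenius associativity
  | frobenius_right (s : B) :
      Rel 𝔥 (comp (tensor (id [s]) (merge s) rfl rfl rfl) (tensor (split s) (id [s]) rfl rfl rfl)
          (n := -2) (by norm_num) : Diag 𝔥 [s, s] [s, s] (-2))
        (comp (split s) (merge s) (by norm_num))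
  | frobenius_left (s : B) :
      Rel 𝔥 (comp (tensor (merge s) (id [s]) rfl rfl rfl) (tensor (id [s]) (split s) rfl rfl rfl)
          (n := -2) (by norm_num) : Diag 𝔥 [s, s] [s, s] (-2))
        (comp (split s) (merge s) (by norm_num))
  -- needle relation
  | needle (s : B) : Rel 𝔥 (comp (merge s) (split s) (n := -2) (by norm_num)) (zero [s] [s] (-2))
  -- barbell relation
  | barbell (s : B) (hs : 𝔥.rootSym s ∈ symDeg k (Module.Dual k V) 1)
      (hd : (2 : ℤ) = 2 * (1 : ℕ)) :
      Rel 𝔥 (comp (endDot s) (startDot s) (n := 2) (by norm_num)) (box 1 (𝔥.rootSym s) hs hd)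
  -- nil-Hecke relation: the polynomial `g` is the image of `f` under the Demazure operator
  | nilHecke (s : B) {n : ℕ} {f g : SymmetricAlgebra k (Module.Dual k V)}
      (hfg : f - 𝔥.reflSym s f = 𝔥.rootSym s * g)
      (hf : f ∈ symDeg k (Module.Dual k V) (n + 1))
      (hsf : 𝔥.reflSym s f ∈ symDeg k (Module.Dual k V) (n + 1))
      (hg : g ∈ symDeg k (Module.Dual k V) n) {d e : ℤ} (hd : d = 2 * (n + 1 : ℕ))
      (he : e = 2 * n) (hde : 1 + (e + 1) = d) :
      Rel 𝔥 (tensor (box (n + 1) f hf hd) (id [s]) rfl rfl (_root_.add_zero d))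
        (add (tensor (id [s]) (box (n + 1) (𝔥.reflSym s f) hsf hd) rfl rfl (_root_.zero_add d))
          (comp (startDot s) (comp (box n g hg he) (endDot s) rfl) hde))
  -- cyclicity of the `2m`-valent vertex
  | cyclic_left (s t : B) (hst : s ≠ t) (hts : t ≠ s) {n : ℕ} (hm : M s t = n + 1)
      (hm' : M t s = n + 1) :
      Rel 𝔥
        (comp
          (tensor (tensor (cap 𝔥 t) (id (alt s t n)) rfl rfl rfl) (id [altLetter s t n])
            (x := t :: (alt t s (n + 1) ++ [altLetter s t n])) rfl (alt_append s t n) rfl)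
          (comp
            (tensor (id [t]) (tensor (vertex s t hst hm n.succ_ne_zero) (id [altLetter s t n])
              rfl rfl rfl) rfl rfl rfl)
            (tensor (id (alt t s (n + 1))) (cup 𝔥 (altLetter s t n)) (List.append_nil _)
              (y := t :: (alt s t (n + 1) ++ [altLetter s t n]))
              (congrArg (List.cons t) (alt_append_append s t n _)) rfl)
            rfl)
          rfl)
        (vertex t s hts hm' n.succ_ne_zero)
  | cyclic_right (s t : B) (hst : s ≠ t) (hts : t ≠ s) {n : ℕ} (hm : M s t = n + 1)
      (hm' : M t s = n + 1) :
      Rel 𝔥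
        (comp
          (tensor (id (s :: alt t s n)) (cap 𝔥 (altLetter t s n))
            (x := s :: (alt t s (n + 1) ++ [altLetter t s n]))
            (congrArg (List.cons s) (alt_append_append t s n _)) (List.append_nil _) rfl)
          (comp
            (tensor (id [s]) (tensor (vertex s t hst hm n.succ_ne_zero) (id [altLetter t s n])
              rfl rfl rfl) rfl rfl rfl)
            (tensor (cup 𝔥 s) (id (alt t s (n + 1))) rfl
              (y := s :: (alt s t (n + 1) ++ [altLetter t s n]))
              (congrArg (fun l => s :: s :: l) (alt_append t s n).symm) rfl)
            rfl)
          rfl)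
        (vertex t s hts hm' n.succ_ne_zero)
  -- `2`-color associativity
  | two_color_assoc (s t : B) (hst : s ≠ t) {n : ℕ} (hm : M s t = n + 1) :
      Rel 𝔥
        (comp
          (tensor (id (alt t s n)) (split (altLetter t s n)) (alt_append t s n)
            (y := alt t s (n + 1) ++ [altLetter t s n]) (alt_append_append t s n _)
            (_root_.zero_add (-1)))
          (vertex s t hst hm n.succ_ne_zero) (n := -1) (by norm_num))
        (comp
          (tensor (vertex s t hst hm n.succ_ne_zero) (id [altLetter t s n]) rfl rfl rfl)
          (comp
            (tensor (id [s]) (vertex s t hst hm n.succ_ne_zero) rfl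
              (y := alt s t (n + 1) ++ [altLetter t s n])
              (congrArg (List.cons s) (alt_append t s n).symm) rfl)
            (tensor (split s) (id (alt t s n)) rfl rfl (_root_.add_zero (-1)))
            (_root_.zero_add (-1)))
          (by norm_num))
  -- Jones–Wenzl relations
  | jones_wenzl (s t : B) (hst : s ≠ t) {n : ℕ} (hm : M s t = n + 2)
      (l : List (k × List (Fin n))) (hl : IsJonesWenzl 𝔥 s t n l) :
      Rel 𝔥
        (comp
          (tensor (id (alt t s (n + 1))) (endDot (altLetter t s (n + 1))) (alt_append t s (n + 1))
            (List.append_nil _) (_root_.zero_add 1))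
          (vertex s t hst hm (n + 1).succ_ne_zero) (n := 1) (by norm_num))
        (comp (tensor (endDot s) (id (alt t s (n + 1))) rfl rfl (_root_.add_zero 1))
          (tlSum 𝔥 s t (n + 2) l) (by norm_num))
  -- Zamolodchikov relations: for a finite standard parabolic subgroup of rank `3`, two rex moves
  -- between reduced expressions of its longest element agree up to the lower terms that are
  -- prescribed by localization
  | zamolodchikov (s t u : B) (hst : s ≠ t) (htu : t ≠ u) (hsu : s ≠ u) {x y : List B}
      (hx : IsLongestExpr cs {s, t, u} x) (hy : IsLongestExpr cs {s, t, u} y)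
      (f g c : Diag 𝔥 x y 0) (hf : IsRexMove f) (hg : IsRexMove g) (hc : IsLower x.length c)
      (hloc : ∀ e ∈ allBools x.length, ∀ h ∈ allBools y.length,
        loc 𝔥 f e h = loc 𝔥 g e h + loc 𝔥 c e h) :
      Rel 𝔥 f (add g c)

end Relations

/-! ## The diagrammatic category `D_BS(𝔥, W)` -/

section Category

variable [IsDomain k] [Module.Free k V] [Module.Finite k V]

/-- The congruence on formal diagrams, as a setoid. -/
instance diagSetoid (𝔥 : Realization cs k V) (w v : List B) (d : ℤ) : Setoid (Diag 𝔥 w v d) where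
  r := Rel 𝔥
  iseqv := ⟨Rel.refl, Rel.symm, Rel.trans⟩

/-- The degree-`d` part of the graded module of morphisms from `B_w` to `B_v` in `D_BS(𝔥, W)`. -/
def Hom (𝔥 : Realization cs k V) (w v : List B) (d : ℤ) : Type _ :=
  Quotient (diagSetoid 𝔥 w v d)

namespace Hom

variable {𝔥 : Realization cs k V} {w v u x : List B} {c d e n p q : ℤ}

/-- The morphism represented by a formal combination of diagrams. -/
def mk (f : Diag 𝔥 w v d) : Hom 𝔥 w v d := Quotient.mk _ f

theorem ind {P : Hom 𝔥 w v d → Prop} (h : ∀ f, P (mk f)) (f : Hom 𝔥 w v d) : P f :=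
  Quotient.ind h f

theorem sound {f g : Diag 𝔥 w v d} (h : Rel 𝔥 f g) : mk f = mk g := Quotient.sound h

instance : Zero (Hom 𝔥 w v d) := ⟨mk (.zero w v d)⟩

instance : Add (Hom 𝔥 w v d) :=
  ⟨Quotient.map₂ Diag.add fun _ _ h _ _ h' => Rel.add_congr h h'⟩

instance : SMul k (Hom 𝔥 w v d) :=
  ⟨fun a => Quotient.map (Diag.smul a) fun _ _ h => Rel.smul_congr a h⟩

instance : Neg (Hom 𝔥 w v d) := ⟨fun f => (-1 : k) • f⟩

theorem add_comm' (f g : Hom 𝔥 w v d) : f + g = g + f := by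
  induction f using ind with | _ f
  induction g using ind with | _ g
  exact sound (Rel.add_comm f g)

theorem zero_add' (f : Hom 𝔥 w v d) : 0 + f = f := by
  induction f using ind with | _ f
  exact sound (Rel.zero_add f)

theorem one_smul' (f : Hom 𝔥 w v d) : (1 : k) • f = f := by
  induction f using ind with | _ f
  exact sound (Rel.one_smul f)

theorem zero_smul' (f : Hom 𝔥 w v d) : (0 : k) • f = 0 := by
  induction f using ind with | _ f
  exact sound (Rel.zero_smul f)

theorem add_smul' (a b : k) (f : Hom 𝔥 w v d) : (a + b) • f = a • f + b • f := by
  induction f using ind with | _ f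
  exact sound (Rel.add_smul a b f)

theorem mul_smul' (a b : k) (f : Hom 𝔥 w v d) : (a * b) • f = a • b • f := by
  induction f using ind with | _ f
  exact sound (Rel.mul_smul a b f)

instance : AddCommGroup (Hom 𝔥 w v d) where
  add_assoc f g h := by
    induction f using ind with | _ f
    induction g using ind with | _ g
    induction h using ind with | _ h
    exact sound (Rel.add_assoc f g h)
  zero_add := zero_add'
  add_zero f := by rw [add_comm', zero_add']
  neg_add_cancel f := by
    change (-1 : k) • f + f = 0
    conv_lhs => rw [← one_smul' f, ← mul_smul', ← add_smul']
    simp [zero_smul']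
  add_comm := add_comm'
  nsmul := nsmulRec
  zsmul := zsmulRec

instance : Module k (Hom 𝔥 w v d) where
  one_smul := one_smul'
  mul_smul := mul_smul'
  add_smul := add_smul'
  zero_smul := zero_smul'
  smul_zero a := by
    rw [← zero_smul' 0, ← mul_smul', mul_zero]
  smul_add a f g := by
    induction f using ind with | _ f
    induction g using ind with | _ g
    exact sound (Rel.smul_add a f g)

/-- Composition in `D_BS(𝔥, W)` (vertical concatenation). -/
def comp (hn : e + d = n) : Hom 𝔥 v u e →ₗ[k] Hom 𝔥 w v d →ₗ[k] Hom 𝔥 w u n :=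
  LinearMap.mk₂ k
    (Quotient.map₂ (fun g f => Diag.comp g f hn) fun _ _ h _ _ h' => Rel.comp_congr hn h h')
    (fun g g' f => by
      induction f using ind with | _ f
      induction g using ind with | _ g
      induction g' using ind with | _ g'
      exact sound (Rel.add_comp g g' f hn))
    (fun a g f => by
      induction f using ind with | _ f
      induction g using ind with | _ g
      exact sound (Rel.smul_comp a g f hn))
    (fun g f f' => by
      induction f using ind with | _ f
      induction f' using ind with | _ f'
      induction g using ind with | _ g
      exact sound (Rel.comp_add g f f' hn))
    (fun a g f => by
      induction f using ind with | _ f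
      induction g using ind with | _ g
      exact sound (Rel.comp_smul a g f hn))

theorem comp_mk (hn : e + d = n) (g : Diag 𝔥 v u e) (f : Diag 𝔥 w v d) :
    comp hn (mk g) (mk f) = mk (Diag.comp g f hn) := rfl

theorem comp_assoc (h : Hom 𝔥 u x c) (g : Hom 𝔥 v u e) (f : Hom 𝔥 w v d) (hp : c + e = p)
    (hq : e + d = q) (hn : p + d = n) (hn' : c + q = n) :
    comp hn (comp hp h g) f = comp hn' h (comp hq g f) := by
  induction f using ind with | _ f
  induction g using ind with | _ g
  induction h using ind with | _ h
  exact sound (Rel.comp_assoc h g f hp hq hn hn')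

/-- The identity of `B_w`. -/
def id (𝔥 : Realization cs k V) (w : List B) (hd : d = 0) : Hom 𝔥 w w d :=
  mk (hd ▸ Diag.id w)

theorem id_comp (f : Hom 𝔥 w v d) (h : e = 0) (h' : e + d = d) : comp h' (id 𝔥 v h) f = f := by
  subst h
  induction f using ind with | _ f
  exact sound (Rel.id_comp f)

theorem comp_id (f : Hom 𝔥 w v d) (h : e = 0) (h' : d + e = d) : comp h' f (id 𝔥 w h) = f := by
  subst h
  induction f using ind with | _ f
  exact sound (Rel.comp_id f)

theorem ι_mem_symDeg (k N : Type*) [CommRing k] [AddCommGroup N] [Module k N] (r : N) :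
    SymmetricAlgebra.ι k N r ∈ symDeg k N 1 := by
  rw [symDeg, pow_one]
  exact ⟨r, rfl⟩

/-- The left action of `r ∈ V^*` on morphisms: adding a box labelled `r` on the left. -/
def lmul (hn : 2 + d = n) : Module.Dual k V →ₗ[k] Hom 𝔥 w v d →ₗ[k] Hom 𝔥 w v n :=
  LinearMap.mk₂ k
    (fun r => Quotient.map
      (fun f => Diag.tensor
        (Diag.box 1 (SymmetricAlgebra.ι k _ r) (ι_mem_symDeg k _ r) (d := 2) (by norm_num))
        f rfl rfl hn)
      fun _ _ h => Rel.tensor_congr rfl rfl hn (Rel.refl _) h)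
    (fun r r' f => by
      induction f using ind with | _ f
      refine sound (Rel.trans (Rel.tensor_congr rfl rfl hn ?_ (Rel.refl f))
        (Rel.add_tensor _ _ f rfl rfl hn))
      have h := map_add (SymmetricAlgebra.ι k (Module.Dual k V)) r r'
      have h' := ι_mem_symDeg k _ (r + r')
      simp only [h] at h' ⊢
      exact Rel.box_add _ _ h' _)
    (fun a r f => by
      induction f using ind with | _ f
      refine sound (Rel.trans (Rel.tensor_congr rfl rfl hn ?_ (Rel.refl f))
        (Rel.smul_tensor _ _ f rfl rfl hn))
      have h := map_smul (SymmetricAlgebra.ι k (Module.Dual k V)) a r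
      have h' := ι_mem_symDeg k _ (a • r)
      simp only [h] at h' ⊢
      exact Rel.box_smul a _ h' _)
    (fun r f f' => by
      induction f using ind with | _ f
      induction f' using ind with | _ f'
      exact sound (Rel.tensor_add _ f f' rfl rfl hn))
    (fun a r f => by
      induction f using ind with | _ f
      exact sound (Rel.tensor_smul a _ f rfl rfl hn))

theorem lmul_comp_left (r : Module.Dual k V) (g : Hom 𝔥 v u e) (f : Hom 𝔥 w v d)
    (hp : e + d = p) (hq : 2 + e = q) (hn : 2 + p = n) (hn' : q + d = n) :
    lmul hn r (comp hp g f) = comp hn' (lmul hq r g) f := by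
  induction f using ind with | _ f
  induction g using ind with | _ g
  refine sound (Rel.trans (Rel.tensor_congr rfl rfl hn (Rel.symm (Rel.comp_id _)) (Rel.refl _)) ?_)
  refine Rel.trans (Rel.interchange _ _ g f rfl rfl rfl _ hp hq (zero_add d) hn hn') ?_
  exact Rel.comp_congr hn' (Rel.refl _) (Rel.nil_tensor f)

theorem lmul_comp_right (r : Module.Dual k V) (g : Hom 𝔥 v u e) (f : Hom 𝔥 w v d)
    (hp : e + d = p) (hq : 2 + d = q) (hn : 2 + p = n) (hn' : e + q = n) :
    lmul hn r (comp hp g f) = comp hn' g (lmul hq r f) := by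
  induction f using ind with | _ f
  induction g using ind with | _ g
  refine sound (Rel.trans (Rel.tensor_congr rfl rfl hn (Rel.symm (Rel.id_comp _)) (Rel.refl _)) ?_)
  refine Rel.trans (Rel.interchange _ _ g f rfl rfl rfl _ hp (zero_add e) hq hn hn') ?_
  exact Rel.comp_congr hn' (Rel.nil_tensor g) (Rel.refl _)

end Hom

/-! ## The additive hull -/

/-- An object of the additive hull `D_BS^⊕(𝔥, W)`: a finite formal direct sum of objects
`B_w(n)`. -/
structure Obj (B : Type*) where
  size : ℕ
  word : Fin size → List B
  deg : Fin size → ℤ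

/-- The shift `X(j)`. -/
def Obj.shift (X : Obj B) (j : ℤ) : Obj B := ⟨X.size, X.word, fun a => X.deg a + j⟩

/-- Morphisms in `D_BS^⊕(𝔥, W)`: matrices of morphisms of `D_BS(𝔥, W)`, where a morphism
`B_w(n) → B_v(m)` is an element of degree `m - n`. -/
abbrev ObjHom (𝔥 : Realization cs k V) (X Y : Obj B) : Type _ :=
  ∀ (a : Fin X.size) (b : Fin Y.size), Hom 𝔥 (X.word a) (Y.word b) (Y.deg b - X.deg a)

/-- The module of morphisms `X → Y(j)` in `D_BS^⊕(𝔥, W)`. -/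
abbrev ShHom (𝔥 : Realization cs k V) (X Y : Obj B) (j : ℤ) : Type _ :=
  ∀ (a : Fin X.size) (b : Fin Y.size), Hom 𝔥 (X.word a) (Y.word b) (Y.deg b + j - X.deg a)

theorem shHom_eq (𝔥 : Realization cs k V) (X Y : Obj B) (j : ℤ) :
    ShHom 𝔥 X Y j = ObjHom 𝔥 X (Y.shift j) := rfl

namespace ShHom

variable {𝔥 : Realization cs k V} {X Y Z T : Obj B} {i j l m n p : ℤ}

theorem comp_deg (hj : l + j = m) (a b c : ℤ) : (c + l - b) + (b + j - a) = c + m - a := by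
  omega

theorem lmul_deg (hj : 2 + j = m) (a b : ℤ) : 2 + (b + j - a) = b + m - a := by omega

/-- The composition `(g, f) ↦ g(j) • f` of `f : X → Y(j)` and `g : Y → Z(l)`. -/
def comp (hj : l + j = m) : ShHom 𝔥 Y Z l →ₗ[k] ShHom 𝔥 X Y j →ₗ[k]
    ShHom 𝔥 X Z m :=
  LinearMap.mk₂ k
    (fun g f a c => ∑ b : Fin Y.size,
      Hom.comp (comp_deg hj (X.deg a) (Y.deg b) (Z.deg c)) (g b c) (f a b))
    (fun g g' f => by
      funext a c
      simp only [Pi.add_apply, map_add, LinearMap.add_apply, Finset.sum_add_distrib])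
    (fun r g f => by
      funext a c
      simp only [Pi.smul_apply, map_smul, LinearMap.smul_apply, Finset.smul_sum])
    (fun g f f' => by
      funext a c
      simp only [Pi.add_apply, map_add, Finset.sum_add_distrib])
    (fun r g f => by
      funext a c
      simp only [Pi.smul_apply, map_smul, Finset.smul_sum])

theorem comp_apply (hj : l + j = m) (g : ShHom 𝔥 Y Z l) (f : ShHom 𝔥 X Y j)
    (a : Fin X.size) (c : Fin Z.size) : comp hj g f a c = ∑ b : Fin Y.size,
      Hom.comp (comp_deg hj (X.deg a) (Y.deg b) (Z.deg c)) (g b c) (f a b) := rfl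

theorem comp_assoc (h : ShHom 𝔥 Z T i) (g : ShHom 𝔥 Y Z l)
    (f : ShHom 𝔥 X Y j) (hp : i + l = p) (hm : l + j = m) (hn : p + j = n)
    (hn' : i + m = n) : comp hn (comp hp h g) f = comp hn' h (comp hm g f) := by
  funext a c
  simp only [comp_apply, map_sum, LinearMap.sum_apply]
  rw [Finset.sum_comm]
  exact Finset.sum_congr rfl fun _ _ => Finset.sum_congr rfl fun _ _ =>
    Hom.comp_assoc _ _ _ _ _ _ _

open Classical in
/-- The identity of `X`, as a morphism `X → X(j)` with `j = 0`. -/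
def id (𝔥 : Realization cs k V) (X : Obj B) (hj : j = 0) : ShHom 𝔥 X X j :=
  fun a b => if h : a = b then
    h ▸ Hom.id 𝔥 (X.word a) (by omega) else 0

theorem id_self (X : Obj B) (hj : j = 0) (a : Fin X.size) :
    id 𝔥 X hj a a = Hom.id 𝔥 (X.word a) (by omega) := by
  simp [id]

theorem id_ne (X : Obj B) (hj : j = 0) {a b : Fin X.size} (h : a ≠ b) : id 𝔥 X hj a b = 0 := by
  simp [id, h]

theorem id_comp (f : ShHom 𝔥 X Y j) (h : i = 0) (h' : i + j = j) :
    comp h' (id 𝔥 Y h) f = f := by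
  funext a c
  rw [comp_apply, Finset.sum_eq_single c]
  · rw [id_self]
    exact Hom.id_comp _ _ _
  · intro b _ hb
    rw [id_ne Y h hb]
    simp
  · simp

theorem comp_id (f : ShHom 𝔥 X Y j) (h : i = 0) (h' : j + i = j) :
    comp h' f (id 𝔥 X h) = f := by
  funext a c
  rw [comp_apply, Finset.sum_eq_single a]
  · rw [id_self]
    exact Hom.comp_id _ _ _
  · intro b _ hb
    rw [id_ne X h (Ne.symm hb)]
    simp
  · simp

/-- The left action of `r ∈ V^*`. -/
def lmul (hj : 2 + j = m) : Module.Dual k V →ₗ[k] ShHom 𝔥 X Y j →ₗ[k]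
    ShHom 𝔥 X Y m :=
  LinearMap.mk₂ k (fun r f a b => Hom.lmul (lmul_deg hj (X.deg a) (Y.deg b)) r (f a b))
    (fun r r' f => by funext a b; simp)
    (fun c r f => by funext a b; simp)
    (fun r f f' => by funext a b; simp)
    (fun c r f => by funext a b; simp)

theorem lmul_apply (hj : 2 + j = m) (r : Module.Dual k V) (f : ShHom 𝔥 X Y j)
    (a : Fin X.size) (b : Fin Y.size) :
    lmul hj r f a b = Hom.lmul (lmul_deg hj (X.deg a) (Y.deg b)) r (f a b) := rfl

theorem lmul_comp_left (r : Module.Dual k V) (g : ShHom 𝔥 Y Z l)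
    (f : ShHom 𝔥 X Y j) (hp : l + j = p) (hm : 2 + l = m) (hn : 2 + p = n)
    (hn' : m + j = n) : lmul hn r (comp hp g f) = comp hn' (lmul hm r g) f := by
  funext a c
  simp only [comp_apply, lmul_apply, map_sum]
  exact Finset.sum_congr rfl fun _ _ => Hom.lmul_comp_left _ _ _ _ _ _ _

theorem lmul_comp_right (r : Module.Dual k V) (g : ShHom 𝔥 Y Z l)
    (f : ShHom 𝔥 X Y j) (hp : l + j = p) (hm : 2 + j = m) (hn : 2 + p = n)
    (hn' : l + m = n) : lmul hn r (comp hp g f) = comp hn' g (lmul hm r f) := by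
  funext a c
  simp only [comp_apply, lmul_apply, map_sum]
  exact Finset.sum_congr rfl fun _ _ => Hom.lmul_comp_right _ _ _ _ _ _ _

end ShHom

/-! ## Sequences and biequivariant morphisms -/

/-- A `D_BS^⊕`-sequence: a sequence of objects, all but finitely many of which are zero (that is,
empty direct sums). -/
structure DSeq (B : Type*) where
  obj : ℤ → Obj B
  finite_support : {i | (obj i).size ≠ 0}.Finite

/-- The part of bidegree `(i, j)` of `uHom_BE(F, G)`: the product over all `p, q` with
`q - p = i - j` of the modules of morphisms `F^p → G^q(j)`. -/
abbrev BEDeg (𝔥 : Realization cs k V) (F G : DSeq B) (i j : ℤ) : Type _ :=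
  ∀ pq : {pq : ℤ × ℤ // pq.2 - pq.1 = i - j}, ShHom 𝔥 (F.obj pq.1.1) (G.obj pq.1.2) j

instance (𝔥 : Realization cs k V) (F G : DSeq B) (i j : ℤ) : AddCommMonoid (BEDeg 𝔥 F G i j) :=
  Pi.addCommMonoid

instance (𝔥 : Realization cs k V) (F G : DSeq B) (i j : ℤ) : AddCommGroup (BEDeg 𝔥 F G i j) :=
  Pi.addCommGroup

instance (𝔥 : Realization cs k V) (F G : DSeq B) (i j : ℤ) : Module k (BEDeg 𝔥 F G i j) :=
  Pi.module _ _ _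

namespace BEDeg

variable {𝔥 : Realization cs k V} {F G H K : DSeq B} {i i' i'' j j' j'' m m' n n' p p' : ℤ}

/-- Composition of homogeneous elements. -/
def comp (hi : i' + i = m) (hj : j' + j = n) :
    BEDeg 𝔥 G H i' j' →ₗ[k] BEDeg 𝔥 F G i j →ₗ[k] BEDeg 𝔥 F H m n :=
  LinearMap.mk₂ k
    (fun g f pr => ShHom.comp hj
      (g ⟨(pr.1.1 + (i - j), pr.1.2), by have := pr.2; dsimp only; omega⟩)
      (f ⟨(pr.1.1, pr.1.1 + (i - j)), by dsimp only; omega⟩))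
    (fun g g' f => by funext pr; simp only [Pi.add_apply, map_add, LinearMap.add_apply])
    (fun c g f => by funext pr; simp only [Pi.smul_apply, map_smul, LinearMap.smul_apply])
    (fun g f f' => by funext pr; simp only [Pi.add_apply, map_add])
    (fun c g f => by funext pr; simp only [Pi.smul_apply, map_smul])

theorem comp_apply (hi : i' + i = m) (hj : j' + j = n) (g : BEDeg 𝔥 G H i' j')
    (f : BEDeg 𝔥 F G i j) (p q r : ℤ) (hq : q - p = i - j) (hqr : r - q = i' - j')
    (hpr : r - p = m - n) :
    comp hi hj g f ⟨(p, r), hpr⟩ = ShHom.comp hj (g ⟨(q, r), hqr⟩) (f ⟨(p, q), hq⟩) := by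
  obtain rfl : q = p + (i - j) := by omega
  rfl

theorem comp_assoc (h : BEDeg 𝔥 H K i'' j'') (g : BEDeg 𝔥 G H i' j') (f : BEDeg 𝔥 F G i j)
    (hm : i'' + i' = m) (hn : j'' + j' = n) (hm' : i' + i = m') (hn' : j' + j = n')
    (hp : m + i = p) (hq : n + j = p') (hp' : i'' + m' = p) (hq' : j'' + n' = p') :
    comp hp hq (comp hm hn h g) f = comp hp' hq' h (comp hm' hn' g f) := by
  funext ⟨⟨a, d⟩, had⟩
  dsimp only at had
  rw [comp_apply hp hq _ _ a (a + (i - j)) d (by omega) (by omega) had,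
    comp_apply hm hn _ _ (a + (i - j)) (a + (i - j) + (i' - j')) d (by omega) (by omega) (by omega),
    comp_apply hp' hq' _ _ a (a + (i - j) + (i' - j')) d (by omega) (by omega) had,
    comp_apply hm' hn' _ _ a (a + (i - j)) (a + (i - j) + (i' - j')) (by omega) (by omega)
      (by omega)]
  exact ShHom.comp_assoc _ _ _ _ _ _ _

/-- The identity of `F`. -/
def id (𝔥 : Realization cs k V) (F : DSeq B) : BEDeg 𝔥 F F 0 0 := fun pq =>
  (show pq.1.1 = pq.1.2 by have := pq.2; omega) ▸ ShHom.id 𝔥 (F.obj pq.1.1) rfl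

theorem id_comp (f : BEDeg 𝔥 F G i j) (hi : 0 + i = i) (hj : 0 + j = j) :
    comp hi hj (id 𝔥 G) f = f := by
  funext ⟨⟨a, b⟩, hab⟩
  dsimp only at hab
  rw [comp_apply hi hj _ _ a b b hab (by omega) hab]
  exact ShHom.id_comp _ rfl _

theorem comp_id (f : BEDeg 𝔥 F G i j) (hi : i + 0 = i) (hj : j + 0 = j) :
    comp hi hj f (id 𝔥 F) = f := by
  funext ⟨⟨a, b⟩, hab⟩
  dsimp only at hab
  rw [comp_apply hi hj _ _ a a b (by omega) hab hab]
  exact ShHom.comp_id _ rfl _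

/-- The left action of `r ∈ V^* = R^2_2` on homogeneous elements. -/
def lmul (hi : 2 + i = m) (hj : 2 + j = n) :
    Module.Dual k V →ₗ[k] BEDeg 𝔥 F G i j →ₗ[k] BEDeg 𝔥 F G m n :=
  LinearMap.mk₂ k
    (fun r f pq => ShHom.lmul hj r (f ⟨pq.1, by have := pq.2; omega⟩))
    (fun r r' f => by funext pr; simp only [Pi.add_apply, map_add, LinearMap.add_apply])
    (fun c r f => by funext pr; simp only [Pi.smul_apply, map_smul, LinearMap.smul_apply])
    (fun r f f' => by funext pr; simp only [Pi.add_apply, map_add])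
    (fun c r f => by funext pr; simp only [Pi.smul_apply, map_smul])

theorem lmul_apply (hi : 2 + i = m) (hj : 2 + j = n) (r : Module.Dual k V) (f : BEDeg 𝔥 F G i j)
    (p q : ℤ) (h : q - p = m - n) (h' : q - p = i - j) :
    lmul hi hj r f ⟨(p, q), h⟩ = ShHom.lmul hj r (f ⟨(p, q), h'⟩) := rfl

theorem lmul_comp_left (r : Module.Dual k V) (g : BEDeg 𝔥 G H i' j') (f : BEDeg 𝔥 F G i j)
    (hm : i' + i = m) (hn : j' + j = n) (hm' : 2 + i' = m') (hn' : 2 + j' = n') (hp : 2 + m = p)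
    (hp' : 2 + n = p') (hq : m' + i = p) (hq' : n' + j = p') :
    lmul hp hp' r (comp hm hn g f) = comp hq hq' (lmul hm' hn' r g) f := by
  funext ⟨⟨a, c⟩, hac⟩
  dsimp only at hac
  rw [lmul_apply hp hp' _ _ a c hac (by omega),
    comp_apply hm hn _ _ a (a + (i - j)) c (by omega) (by omega) (by omega),
    comp_apply hq hq' _ _ a (a + (i - j)) c (by omega) (by omega) hac,
    lmul_apply hm' hn' _ _ _ _ _ (by omega)]
  exact ShHom.lmul_comp_left _ _ _ _ _ _ _

theorem lmul_comp_right (r : Module.Dual k V) (g : BEDeg 𝔥 G H i' j') (f : BEDeg 𝔥 F G i j)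
    (hm : i' + i = m) (hn : j' + j = n) (hm' : 2 + i = m') (hn' : 2 + j = n') (hp : 2 + m = p)
    (hp' : 2 + n = p') (hq : i' + m' = p) (hq' : j' + n' = p') :
    lmul hp hp' r (comp hm hn g f) = comp hq hq' g (lmul hm' hn' r f) := by
  funext ⟨⟨a, c⟩, hac⟩
  dsimp only at hac
  rw [lmul_apply hp hp' _ _ a c hac (by omega),
    comp_apply hm hn _ _ a (a + (i - j)) c (by omega) (by omega) (by omega),
    comp_apply hq hq' _ _ a (a + (i - j)) c (by omega) (by omega) hac,
    lmul_apply hm' hn' _ _ _ _ _ (by omega)]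
  exact ShHom.lmul_comp_right _ _ _ _ _ _ _

end BEDeg

/-- The bigraded module `uHom_BE(F, G)`. -/
abbrev BE (𝔥 : Realization cs k V) (F G : DSeq B) : Type _ :=
  ⨁ ij : ℤ × ℤ, BEDeg 𝔥 F G ij.1 ij.2

instance (𝔥 : Realization cs k V) (F G : DSeq B) : AddCommMonoid (BE 𝔥 F G) :=
  inferInstance

instance (𝔥 : Realization cs k V) (F G : DSeq B) : AddCommGroup (BE 𝔥 F G) :=
  inferInstance

instance (𝔥 : Realization cs k V) (F G : DSeq B) : Module k (BE 𝔥 F G) :=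
  inferInstance

namespace BE

variable {𝔥 : Realization cs k V} {F G H K : DSeq B}

/-- The inclusion of the part of bidegree `(i, j)`. -/
abbrev of (𝔥 : Realization cs k V) (F G : DSeq B) (i j : ℤ) : BEDeg 𝔥 F G i j →ₗ[k] BE 𝔥 F G :=
  DirectSum.lof k (ℤ × ℤ) (fun ij => BEDeg 𝔥 F G ij.1 ij.2) (i, j)

/-- Composition `uHom_BE(G, H) ⊗ uHom_BE(F, G) → uHom_BE(F, H)`. -/
def comp : BE 𝔥 G H →ₗ[k] BE 𝔥 F G →ₗ[k] BE 𝔥 F H :=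
  DirectSum.toModule k _ _ fun ij => LinearMap.flip <| DirectSum.toModule k _ _ fun ij' =>
    LinearMap.flip <| (BEDeg.comp rfl rfl).compr₂ (of 𝔥 F H (ij.1 + ij'.1) (ij.2 + ij'.2))

theorem comp_of {i i' j j' m n : ℤ} (hm : i' + i = m) (hn : j' + j = n) (g : BEDeg 𝔥 G H i' j')
    (f : BEDeg 𝔥 F G i j) :
    comp (of 𝔥 G H i' j' g) (of 𝔥 F G i j f) = of 𝔥 F H m n (BEDeg.comp hm hn g f) := by
  subst hm hn
  simp [comp, of]

theorem induction {P : BE 𝔥 F G → Prop} (f : BE 𝔥 F G) (zero : P 0)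
    (add : ∀ f g, P f → P g → P (f + g)) (hof : ∀ i j f, P (of 𝔥 F G i j f)) : P f :=
  DirectSum.induction_on f zero (fun ij f => hof ij.1 ij.2 f) add

theorem comp_assoc (h : BE 𝔥 H K) (g : BE 𝔥 G H) (f : BE 𝔥 F G) :
    comp (comp h g) f = comp h (comp g f) := by
  induction h using induction with
  | zero => simp
  | add h h' ih ih' => simp only [map_add, LinearMap.add_apply, ih, ih']
  | hof i'' j'' h =>
  induction g using induction with
  | zero => simp
  | add g g' ih ih' => simp only [map_add, LinearMap.add_apply, ih, ih']
  | hof i' j' g =>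
  induction f using induction with
  | zero => simp
  | add f f' ih ih' => simp only [map_add, ih, ih']
  | hof i j f =>
  rw [comp_of rfl rfl, comp_of rfl rfl, comp_of rfl rfl,
    comp_of (add_assoc i'' i' i).symm (add_assoc j'' j' j).symm]
  exact congrArg _ (BEDeg.comp_assoc _ _ _ _ _ _ _ _ _ _ _)

/-- The identity of `F`, of bidegree `(0, 0)`. -/
def id (𝔥 : Realization cs k V) (F : DSeq B) : BE 𝔥 F F := of 𝔥 F F 0 0 (BEDeg.id 𝔥 F)

theorem id_comp (f : BE 𝔥 F G) : comp (id 𝔥 G) f = f := by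
  induction f using induction with
  | zero => simp
  | add f f' ih ih' => simp only [map_add, ih, ih']
  | hof i j f =>
  rw [id, comp_of (zero_add i) (zero_add j), BEDeg.id_comp]

theorem comp_id (f : BE 𝔥 F G) : comp f (id 𝔥 F) = f := by
  induction f using induction with
  | zero => simp
  | add f f' ih ih' => simp only [map_add, LinearMap.add_apply, ih, ih']
  | hof i j f =>
  rw [id, comp_of (add_zero i) (add_zero j), BEDeg.comp_id]

/-- The left action of `r ∈ V^*` on `uHom_BE(F, G)`, i.e. `f ↦ r ⋆ f`. -/
def lmul : Module.Dual k V →ₗ[k] BE 𝔥 F G →ₗ[k] BE 𝔥 F G :=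
  LinearMap.flip <| DirectSum.toModule k _ _ fun ij =>
    LinearMap.flip <| (BEDeg.lmul rfl rfl).compr₂ (of 𝔥 F G (2 + ij.1) (2 + ij.2))

theorem lmul_of {i j m n : ℤ} (hm : 2 + i = m) (hn : 2 + j = n) (r : Module.Dual k V)
    (f : BEDeg 𝔥 F G i j) : lmul r (of 𝔥 F G i j f) = of 𝔥 F G m n (BEDeg.lmul hm hn r f) := by
  subst hm hn
  simp [lmul, of]

theorem lmul_comp_left (r : Module.Dual k V) (g : BE 𝔥 G H) (f : BE 𝔥 F G) :
    lmul r (comp g f) = comp (lmul r g) f := by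
  induction g using induction with
  | zero => simp
  | add g g' ih ih' => simp only [map_add, LinearMap.add_apply, ih, ih']
  | hof i' j' g =>
  induction f using induction with
  | zero => simp
  | add f f' ih ih' => simp only [map_add, ih, ih']
  | hof i j f =>
  rw [comp_of rfl rfl, lmul_of rfl rfl, lmul_of rfl rfl,
    comp_of (add_assoc 2 i' i) (add_assoc 2 j' j)]
  exact congrArg _ (BEDeg.lmul_comp_left _ _ _ _ _ _ _ _ _ _ _)

theorem lmul_comp_right (r : Module.Dual k V) (g : BE 𝔥 G H) (f : BE 𝔥 F G) :
    lmul r (comp g f) = comp g (lmul r f) := by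
  induction g using induction with
  | zero => simp
  | add g g' ih ih' => simp only [map_add, LinearMap.add_apply, ih, ih']
  | hof i' j' g =>
  induction f using induction with
  | zero => simp
  | add f f' ih ih' => simp only [map_add, ih, ih']
  | hof i j f =>
  rw [comp_of rfl rfl, lmul_of rfl rfl, lmul_of rfl rfl,
    comp_of (m := 2 + (i' + i)) (n := 2 + (j' + j)) (by omega) (by omega)]
  exact congrArg _ (BEDeg.lmul_comp_right _ _ _ _ _ _ _ _ _ _ _)

/-- The operator acting by `(-1)^i` in cohomological degree `i`. -/
def sgn : BE 𝔥 F G →ₗ[k] BE 𝔥 F G :=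
  DirectSum.toModule k _ _ fun ij => (ij.1.negOnePow : ℤ) • of 𝔥 F G ij.1 ij.2

theorem sgn_of (i j : ℤ) (f : BEDeg 𝔥 F G i j) :
    sgn (of 𝔥 F G i j f) = (i.negOnePow : ℤ) • of 𝔥 F G i j f := by
  simp [sgn, of]

end BE

/-! ## Left-monodromic morphisms -/

/-- The exterior algebra `Λ` of `V^*`; the part `⋀^n V^*` has bidegree `(n, 2n)`. -/
abbrev Lam (k V : Type*) [CommRing k] [AddCommGroup V] [Module k V] : Type _ :=
  ExteriorAlgebra k (Module.Dual k V)

/-- The involution of `Λ` acting by `(-1)^n` on `⋀^n V^*`. -/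
abbrev lamSgn (k V : Type*) [CommRing k] [AddCommGroup V] [Module k V] : Lam k V ≃ₐ[k] Lam k V :=
  CliffordAlgebra.involuteEquiv

/-- The contraction of elements of `Λ` with `x ∈ V`. -/
def contract (x : V) : Lam k V →ₗ[k] Lam k V :=
  CliffordAlgebra.contractLeft (Module.Dual.eval k V x)

/-- The bigraded module `uHom_LM(F, G) = Λ ⊗ uHom_BE(F, G)`. -/
abbrev LM (𝔥 : Realization cs k V) (F G : DSeq B) : Type _ := Lam k V ⊗[k] BE 𝔥 F G

instance (𝔥 : Realization cs k V) (F G : DSeq B) : AddCommMonoid (LM 𝔥 F G) :=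
  TensorProduct.addCommMonoid

instance (𝔥 : Realization cs k V) (F G : DSeq B) : AddCommGroup (LM 𝔥 F G) :=
  TensorProduct.addCommGroup

instance (𝔥 : Realization cs k V) (F G : DSeq B) : Module k (LM 𝔥 F G) :=
  TensorProduct.leftModule

namespace LM

variable {𝔥 : Realization cs k V} {F G H K : DSeq B}

/-- The part of bidegree `(i, j)` of `uHom_LM(F, G)`. -/
def bideg (𝔥 : Realization cs k V) (F G : DSeq B) (i j : ℤ) : Submodule k (LM 𝔥 F G) :=
  Submodule.span k {z | ∃ (n : ℕ) (r : Lam k V) (a b : ℤ) (f : BEDeg 𝔥 F G a b),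
    r ∈ ⋀[k]^n (Module.Dual k V) ∧ n + a = i ∧ 2 * n + b = j ∧ z = r ⊗ₜ[k] BE.of 𝔥 F G a b f}

/-- Composition in `uHom_LM`: `(r ⊗ f) ∘ (s ⊗ g) = (-1)^{|f||s|} (r ∧ s) ⊗ (f ∘ g)`. -/
def comp : LM 𝔥 G H →ₗ[k] LM 𝔥 F G →ₗ[k] LM 𝔥 F H :=
  TensorProduct.lift <| LinearMap.flip <| DirectSum.toModule k _ _ fun ij => LinearMap.flip <|
    TensorProduct.curry <| TensorProduct.map₂
      ((LinearMap.mul k (Lam k V)).compl₂ (lamSgn k V ^ ij.1).toLinearMap)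
      (BE.comp ∘ₗ BE.of 𝔥 G H ij.1 ij.2)

theorem comp_tmul (i j : ℤ) (r s : Lam k V) (g : BEDeg 𝔥 G H i j) (f : BE 𝔥 F G) :
    comp (r ⊗ₜ[k] BE.of 𝔥 G H i j g) (s ⊗ₜ[k] f) =
      (r * (lamSgn k V ^ i) s) ⊗ₜ[k] BE.comp (BE.of 𝔥 G H i j g) f := by
  simp [comp, BE.of]

theorem induction {P : LM 𝔥 F G → Prop} (f : LM 𝔥 F G) (zero : P 0)
    (add : ∀ f g, P f → P g → P (f + g))
    (tmul : ∀ r i j f, P (r ⊗ₜ[k] BE.of 𝔥 F G i j f)) : P f := by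
  induction f using TensorProduct.induction_on with
  | zero => exact zero
  | add f g hf hg => exact add f g hf hg
  | tmul r f =>
  induction f using BE.induction with
  | zero => rw [TensorProduct.tmul_zero]; exact zero
  | add f g hf hg => rw [TensorProduct.tmul_add]; exact add _ _ hf hg
  | hof i j f => exact tmul r i j f

theorem comp_assoc (h : LM 𝔥 H K) (g : LM 𝔥 G H) (f : LM 𝔥 F G) :
    comp (comp h g) f = comp h (comp g f) := by
  induction h using induction with
  | zero => simp
  | add h h' ih ih' => simp only [map_add, LinearMap.add_apply, ih, ih']
  | tmul r i'' j'' h =>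
  induction g using induction with
  | zero => simp
  | add g g' ih ih' => simp only [map_add, LinearMap.add_apply, ih, ih']
  | tmul s i' j' g =>
  induction f using induction with
  | zero => simp
  | add f f' ih ih' => simp only [map_add, ih, ih']
  | tmul t i j f =>
  rw [comp_tmul, BE.comp_of rfl rfl, comp_tmul, comp_tmul, comp_tmul,
    ← BE.comp_of rfl rfl h g, BE.comp_assoc, map_mul, zpow_add, AlgEquiv.mul_apply, mul_assoc]

/-- The identity of `F`. -/
def id (𝔥 : Realization cs k V) (F : DSeq B) : LM 𝔥 F F := 1 ⊗ₜ[k] BE.id 𝔥 F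

theorem id_comp (f : LM 𝔥 F G) : comp (id 𝔥 G) f = f := by
  induction f using induction with
  | zero => simp
  | add f f' ih ih' => simp only [map_add, ih, ih']
  | tmul r i j f =>
  rw [id, BE.id, comp_tmul, ← BE.id, BE.id_comp, zpow_zero, AlgEquiv.one_apply, one_mul]

theorem comp_id (f : LM 𝔥 F G) : comp f (id 𝔥 F) = f := by
  induction f using induction with
  | zero => simp
  | add f f' ih ih' => simp only [map_add, LinearMap.add_apply, ih, ih']
  | tmul r i j f =>
  rw [id, comp_tmul, BE.comp_id, map_one, mul_one]

/-- The operator acting by `(-1)^i` in cohomological degree `i`. -/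
def sgn : LM 𝔥 F G →ₗ[k] LM 𝔥 F G := TensorProduct.map (lamSgn k V).toLinearMap BE.sgn

/-- The map `κ`, written with the help of a basis `(b_a)` of `V` and its dual basis `(b_a^*)` as
`κ(r ⊗ f) = ∑_a (b_a ⌢ r) ⊗ (b_a^* ⋆ f)`. -/
def kappa : LM 𝔥 F G →ₗ[k] LM 𝔥 F G :=
  ∑ a, TensorProduct.map (contract (Module.Free.chooseBasis k V a))
    (BE.lmul ((Module.Free.chooseBasis k V).coord a))

/-- The contraction of elements of `uHom_LM(F, G)` with `x ∈ V`. -/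
def frown (x : V) : LM 𝔥 F G →ₗ[k] LM 𝔥 F G := TensorProduct.map (contract x) LinearMap.id

theorem kappa_tmul (r : Lam k V) (f : BE 𝔥 F G) : kappa (r ⊗ₜ[k] f) =
    ∑ a, contract (Module.Free.chooseBasis k V a) r ⊗ₜ[k]
      BE.lmul ((Module.Free.chooseBasis k V).coord a) f := by
  simp [kappa, LinearMap.sum_apply]

theorem kappa_one_tmul (f : BE 𝔥 F G) : kappa ((1 : Lam k V) ⊗ₜ[k] f) = 0 := by
  simp [kappa_tmul, contract]

/-- Together with `kappa_one_tmul`, this recursion shows that `κ` does not depend on the choice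
of the basis and that `κ ((r_1 ∧ ⋯ ∧ r_n) ⊗ f)` is the alternating sum over `i` of
`(r_1 ∧ ⋯ r̂_i ⋯ ∧ r_n) ⊗ (r_i ⋆ f)`. -/
theorem kappa_ι_mul_tmul (r : Module.Dual k V) (s : Lam k V) (f : BE 𝔥 F G) :
    kappa ((ExteriorAlgebra.ι k r * s) ⊗ₜ[k] f) = s ⊗ₜ[k] BE.lmul r f -
      TensorProduct.map (LinearMap.mulLeft k (ExteriorAlgebra.ι k r)) LinearMap.id
        (kappa (s ⊗ₜ[k] f)) := by
  have h : r = ∑ a, r (Module.Free.chooseBasis k V a) • (Module.Free.chooseBasis k V).coord a :=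
    (Module.Free.chooseBasis k V).ext fun c => by
      simp
  have h' : ∀ a, contract (Module.Free.chooseBasis k V a) (ExteriorAlgebra.ι k r * s) =
      r (Module.Free.chooseBasis k V a) • s -
        ExteriorAlgebra.ι k r * contract (Module.Free.chooseBasis k V a) s := fun a =>
    CliffordAlgebra.contractLeft_ι_mul _ _ _
  conv_rhs => enter [1]; rw [h]
  simp only [kappa_tmul, h', TensorProduct.sub_tmul, Finset.sum_sub_distrib, map_sum, map_smul,
    TensorProduct.map_tmul, LinearMap.mulLeft_apply, LinearMap.id_apply, LinearMap.sum_apply,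
    LinearMap.smul_apply, TensorProduct.tmul_sum, TensorProduct.smul_tmul]

theorem contract_mul (x : V) (r s : Lam k V) :
    contract x (r * s) = contract x r * s + lamSgn k V r * contract x s := by
  induction r using CliffordAlgebra.left_induction with
  | algebraMap c =>
    rw [AlgEquiv.commutes]
    simp only [contract, CliffordAlgebra.contractLeft_algebraMap_mul,
      CliffordAlgebra.contractLeft_algebraMap, zero_mul, zero_add]
  | add r r' hr hr' => rw [add_mul, map_add, hr, hr', map_add, map_add]; noncomm_ring
  | ι_mul r m hr =>
    have e : ∀ t : Lam k V, contract x (CliffordAlgebra.ι 0 m * t) =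
        m x • t - CliffordAlgebra.ι 0 m * contract x t := fun t =>
      CliffordAlgebra.contractLeft_ι_mul _ _ _
    rw [mul_assoc, e, hr, e, map_mul]
    have e' : lamSgn k V (CliffordAlgebra.ι 0 m) = -CliffordAlgebra.ι 0 m :=
      CliffordAlgebra.involute_ι m
    rw [e']
    simp only [sub_mul, mul_add, smul_mul_assoc, neg_mul, mul_assoc]
    abel

theorem contract_lamSgn (x : V) (r : Lam k V) :
    contract x (lamSgn k V r) = -lamSgn k V (contract x r) := by
  induction r using CliffordAlgebra.left_induction with
  | algebraMap c =>
    rw [AlgEquiv.commutes]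
    simp only [contract, CliffordAlgebra.contractLeft_algebraMap, map_zero, neg_zero]
  | add r r' hr hr' => simp only [map_add, hr, hr']; abel
  | ι_mul r m hr =>
    have e : ∀ t : Lam k V, contract x (CliffordAlgebra.ι 0 m * t) =
        m x • t - CliffordAlgebra.ι 0 m * contract x t := fun t =>
      CliffordAlgebra.contractLeft_ι_mul _ _ _
    have e' : lamSgn k V (CliffordAlgebra.ι 0 m) = -CliffordAlgebra.ι 0 m :=
      CliffordAlgebra.involute_ι m
    rw [map_mul, e', neg_mul, map_neg, e, hr, e, map_sub, map_smul, map_mul, e']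
    simp only [mul_neg, neg_mul, sub_neg_eq_add]

theorem lamSgn_lamSgn (r : Lam k V) : lamSgn k V (lamSgn k V r) = r :=
  CliffordAlgebra.involute_involute r

theorem lamSgn_zpow_two_add (i : ℤ) (r : Lam k V) :
    (lamSgn k V ^ (2 + i)) r = (lamSgn k V ^ i) r := by
  rw [zpow_add, AlgEquiv.mul_apply, zpow_two, AlgEquiv.mul_apply, lamSgn_lamSgn]

theorem contract_lamSgn_zpow (x : V) (i : ℤ) (r : Lam k V) :
    contract x ((lamSgn k V ^ i) r) = (i.negOnePow : ℤ) • (lamSgn k V ^ i) (contract x r) := by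
  induction i using Int.induction_on generalizing r with
  | zero => simp
  | succ i ih =>
    rw [zpow_add, zpow_one, AlgEquiv.mul_apply, ih, contract_lamSgn, Int.negOnePow_succ]
    simp
  | pred i ih =>
    have e : (lamSgn k V ^ (-(i : ℤ) - 1)) = lamSgn k V ^ (-(i : ℤ) + 1) := by
      ext t
      rw [← lamSgn_zpow_two_add (-(i : ℤ) - 1)]
      congr 2
      ring
    rw [e, zpow_add, zpow_one, AlgEquiv.mul_apply, ih, contract_lamSgn, Int.negOnePow_sub]
    simp

theorem sgn_tmul (r : Lam k V) (i j : ℤ) (f : BEDeg 𝔥 F G i j) :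
    sgn (r ⊗ₜ[k] BE.of 𝔥 F G i j f) =
      (i.negOnePow : ℤ) • (lamSgn k V r ⊗ₜ[k] BE.of 𝔥 F G i j f) := by
  rw [sgn, TensorProduct.map_tmul, BE.sgn_of, TensorProduct.tmul_smul]
  rfl

theorem kappa_comp (g : LM 𝔥 G H) (f : LM 𝔥 F G) :
    kappa (comp g f) = comp (kappa g) f + comp (sgn g) (kappa f) := by
  induction g using induction with
  | zero => simp
  | add g g' ih ih' => simp only [map_add, LinearMap.add_apply, ih, ih']; abel
  | tmul r i' j' g =>
  induction f using induction with
  | zero => simp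
  | add f f' ih ih' => simp only [map_add, ih, ih']; abel
  | tmul s i j f =>
  have e1 : ∀ (t : Lam k V) (r' : Module.Dual k V),
      comp (t ⊗ₜ[k] BE.lmul r' (BE.of 𝔥 G H i' j' g)) (s ⊗ₜ[k] BE.of 𝔥 F G i j f) =
        (t * (lamSgn k V ^ i') s) ⊗ₜ[k]
          BE.lmul r' (BE.comp (BE.of 𝔥 G H i' j' g) (BE.of 𝔥 F G i j f)) := by
    intro t r'
    rw [BE.lmul_comp_left, BE.lmul_of rfl rfl, comp_tmul, lamSgn_zpow_two_add]
  have e2 : ∀ (t : Lam k V) (r' : Module.Dual k V),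
      comp (sgn (r ⊗ₜ[k] BE.of 𝔥 G H i' j' g)) (t ⊗ₜ[k] BE.lmul r' (BE.of 𝔥 F G i j f)) =
        (lamSgn k V r * ((i'.negOnePow : ℤ) • (lamSgn k V ^ i') t)) ⊗ₜ[k]
          BE.lmul r' (BE.comp (BE.of 𝔥 G H i' j' g) (BE.of 𝔥 F G i j f)) := by
    intro t r'
    rw [BE.lmul_comp_right, sgn_tmul, map_zsmul, LinearMap.smul_apply, comp_tmul, mul_smul_comm]
    rfl
  rw [comp_tmul, kappa_tmul, kappa_tmul, kappa_tmul, map_sum, map_sum, LinearMap.sum_apply,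
    ← Finset.sum_add_distrib]
  refine Finset.sum_congr rfl fun a _ => ?_
  rw [e1, e2, contract_mul, contract_lamSgn_zpow, TensorProduct.add_tmul]

theorem sgn_comp (g : LM 𝔥 G H) (f : LM 𝔥 F G) : sgn (comp g f) = comp (sgn g) (sgn f) := by
  induction g using induction with
  | zero => simp
  | add g g' ih ih' => simp only [map_add, LinearMap.add_apply, ih, ih']
  | tmul r i' j' g =>
  induction f using induction with
  | zero => simp
  | add f f' ih ih' => simp only [map_add, ih, ih']
  | tmul s i j f =>
  rw [comp_tmul, BE.comp_of rfl rfl, sgn_tmul, sgn_tmul, sgn_tmul, map_zsmul, map_zsmul,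
    LinearMap.smul_apply, comp_tmul, BE.comp_of rfl rfl, map_mul, Int.negOnePow_add,
    ← AlgEquiv.mul_apply, ← AlgEquiv.mul_apply, ← zpow_one_add, ← zpow_add_one, add_comm 1 i',
    smul_smul, Units.val_mul, mul_comm]

theorem sgn_sgn (f : LM 𝔥 F G) : sgn (sgn f) = f := by
  induction f using induction with
  | zero => simp
  | add f f' ih ih' => simp only [map_add, ih, ih']
  | tmul r i j f =>
  rw [sgn_tmul, map_zsmul, sgn_tmul, lamSgn_lamSgn, smul_smul, ← Units.val_mul,
    Int.units_mul_self, Units.val_one, one_smul]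

theorem kappa_sgn (f : LM 𝔥 F G) : kappa (sgn f) = -sgn (kappa f) := by
  induction f using induction with
  | zero => simp
  | add f f' ih ih' => simp only [map_add, ih, ih']; abel
  | tmul r i j f =>
  rw [sgn_tmul, map_zsmul, kappa_tmul, kappa_tmul, map_sum, Finset.smul_sum,
    ← Finset.sum_neg_distrib]
  refine Finset.sum_congr rfl fun a _ => ?_
  rw [contract_lamSgn, BE.lmul_of rfl rfl, sgn_tmul, TensorProduct.neg_tmul, smul_neg,
    Int.negOnePow_add, Int.negOnePow_even 2 even_two, one_mul]

theorem sgn_id : sgn (id 𝔥 F) = id 𝔥 F := by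
  rw [id, BE.id, sgn_tmul]
  simp

theorem sgn_of_mem {i j : ℤ} {f : LM 𝔥 F G} (hf : f ∈ bideg 𝔥 F G i j) :
    sgn f = (i.negOnePow : ℤ) • f := by
  induction hf using Submodule.span_induction with
  | mem z hz =>
    obtain ⟨n, r, a, b, f, hr, rfl, rfl, rfl⟩ := hz
    have h : lamSgn k V r = ((n : ℤ).negOnePow : ℤ) • r := by
      clear f
      induction n generalizing r with
      | zero =>
        rw [ExteriorAlgebra.exteriorPower, pow_zero, Submodule.mem_one] at hr
        obtain ⟨c, rfl⟩ := hr
        rw [AlgEquiv.commutes]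
        simp
      | succ n ih =>
        rw [ExteriorAlgebra.exteriorPower, pow_succ] at hr
        induction hr using Submodule.mul_induction_on' with
        | mem_mul_mem s hs t ht =>
          obtain ⟨m, rfl⟩ := ht
          have e' : lamSgn k V (ExteriorAlgebra.ι k m) = -ExteriorAlgebra.ι k m :=
            CliffordAlgebra.involute_ι m
          rw [map_mul, e', ih s hs, Nat.cast_succ, Int.negOnePow_succ]
          simp [mul_assoc]
        | add s _ t _ hs ht => rw [map_add, hs, ht, smul_add]
    rw [sgn_tmul, h, Int.negOnePow_add, mul_comm, Units.val_mul, ← smul_smul]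
    rfl
  | zero => simp
  | add x y _ _ hx hy => rw [map_add, hx, hy, smul_add]
  | smul c x _ hx => rw [map_smul, hx, smul_comm]

end LM

/-! ## The left-monodromic category -/

/-- A left-monodromic complex, i.e. an object of `LM(𝔥, W)`. -/
structure LMObj (𝔥 : Realization cs k V) where
  seq : DSeq B
  δ : LM 𝔥 seq seq
  δ_mem : δ ∈ LM.bideg 𝔥 seq seq 1 0
  eq : LM.comp δ δ + LM.kappa δ = 0

section Cohomology

variable {𝔥 : Realization cs k V}

/-- The differential of `uHom_LM(F, G)`:
`d(f) = κ(f) + δ_G ∘ f + (-1)^{|f| + 1} f ∘ δ_F`. -/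
def differential (F G : LMObj 𝔥) : LM 𝔥 F.seq G.seq →ₗ[k] LM 𝔥 F.seq G.seq :=
  LM.kappa + LM.comp G.δ - (LM.comp.flip F.δ) ∘ₗ LM.sgn

variable {F G H K : LMObj 𝔥}

theorem differential_apply (f : LM 𝔥 F.seq G.seq) :
    differential F G f = LM.kappa f + LM.comp G.δ f - LM.comp (LM.sgn f) F.δ := rfl

theorem differential_comp (g : LM 𝔥 G.seq H.seq) (f : LM 𝔥 F.seq G.seq) :
    differential F H (LM.comp g f) =
      LM.comp (differential G H g) f + LM.comp (LM.sgn g) (differential F G f) := by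
  simp only [differential_apply, LM.kappa_comp, LM.sgn_comp, map_add, map_sub, LinearMap.add_apply,
    LinearMap.sub_apply, LM.comp_assoc]
  abel

theorem differential_sgn (f : LM 𝔥 F.seq G.seq) :
    differential F G (LM.sgn f) = -LM.sgn (differential F G f) := by
  have hF := LM.sgn_of_mem F.δ_mem
  have hG := LM.sgn_of_mem G.δ_mem
  rw [Int.negOnePow_one, Units.val_neg, Units.val_one, neg_smul, one_smul] at hF hG
  simp only [differential_apply, LM.kappa_sgn, LM.sgn_comp, map_add, map_sub, LM.sgn_sgn, hF, hG,
    map_neg, LinearMap.neg_apply]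
  abel

theorem differential_id : differential F F (LM.id 𝔥 F.seq) = 0 := by
  rw [differential_apply, LM.sgn_id, LM.id_comp, LM.comp_id, LM.id, LM.kappa_one_tmul, zero_add,
    sub_self]

variable (F G) in
/-- The cocycles of `uHom_LM(F, G)`. -/
abbrev cocycles : Submodule k (LM 𝔥 F.seq G.seq) := LinearMap.ker (differential F G)

variable (F G) in
/-- The coboundaries of `uHom_LM(F, G)`, as a submodule of the module of cocycles. -/
abbrev coboundaries : Submodule k (cocycles F G) :=
  (LinearMap.range (differential F G)).submoduleOf (cocycles F G)

/-- The (total) cohomology `gHom_LM(F, G)` of `uHom_LM(F, G)`: cocycles modulo coboundaries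
(every coboundary is a cocycle, since `d ∘ d = 0`). -/
def gHom (F G : LMObj 𝔥) : Type _ := cocycles F G ⧸ coboundaries F G

instance : AddCommGroup (gHom F G) :=
  inferInstanceAs (AddCommGroup (cocycles F G ⧸ coboundaries F G))

instance : Module k (gHom F G) := inferInstanceAs (Module k (cocycles F G ⧸ coboundaries F G))

namespace gHom

/-- The cohomology class of a cocycle, as a linear map. -/
def cls : cocycles F G →ₗ[k] gHom F G := (coboundaries F G).mkQ

/-- The cohomology class of a cocycle. -/
def mk (f : LM 𝔥 F.seq G.seq) (hf : differential F G f = 0) : gHom F G := cls ⟨f, hf⟩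

theorem ind {P : gHom F G → Prop} (h : ∀ f hf, P (mk f hf)) (f : gHom F G) : P f := by
  obtain ⟨⟨f, hf⟩, rfl⟩ := Submodule.mkQ_surjective (coboundaries F G) f
  exact h f hf

/-- Two cocycles are cohomologous if and only if their difference is a coboundary. -/
theorem mk_eq_mk (f f' : LM 𝔥 F.seq G.seq) (hf : differential F G f = 0)
    (hf' : differential F G f' = 0) :
    mk f hf = mk f' hf' ↔ ∃ h, differential F G h = f - f' :=
  Submodule.Quotient.eq (coboundaries F G)

/-- The part of bidegree `(i, j)` of `gHom_LM(F, G)`: the classes of the cocycles of bidegree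
`(i, j)`. -/
def bideg (F G : LMObj 𝔥) (i j : ℤ) : Submodule k (gHom F G) :=
  ((LM.bideg 𝔥 F.seq G.seq i j).submoduleOf (cocycles F G)).map cls

theorem differential_comp_eq_zero {g : LM 𝔥 G.seq H.seq} {f : LM 𝔥 F.seq G.seq}
    (hg : differential G H g = 0) (hf : differential F G f = 0) :
    differential F H (LM.comp g f) = 0 := by
  rw [differential_comp, hg, hf, map_zero, LinearMap.zero_apply, map_zero, add_zero]

/-- The composition of cocycles, with values in cohomology. -/
def preComp : cocycles G H →ₗ[k] cocycles F G →ₗ[k] gHom F H :=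
  LinearMap.mk₂ k (fun g f => mk (LM.comp g.1 f.1) (differential_comp_eq_zero g.2 f.2))
    (fun g g' f => by
      refine Eq.trans (congrArg cls (Subtype.ext ?_)) (map_add cls _ _)
      exact LinearMap.map_add₂ LM.comp g.1 g'.1 f.1)
    (fun c g f => by
      refine Eq.trans (congrArg cls (Subtype.ext ?_)) (map_smul cls c _)
      exact LinearMap.map_smul₂ LM.comp c g.1 f.1)
    (fun g f f' => by
      refine Eq.trans (congrArg cls (Subtype.ext ?_)) (map_add cls _ _)
      exact map_add (LM.comp g.1) f.1 f'.1)
    (fun c g f => by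
      refine Eq.trans (congrArg cls (Subtype.ext ?_)) (map_smul cls c _)
      exact map_smul (LM.comp g.1) c f.1)

theorem preComp_apply (g : cocycles G H) (f : cocycles F G) :
    preComp g f = mk (LM.comp g.1 f.1) (differential_comp_eq_zero g.2 f.2) := rfl

theorem mk_eq_zero {f : LM 𝔥 F.seq G.seq} {hf : differential F G f = 0}
    (h : ∃ h, differential F G h = f) : mk f hf = 0 :=
  (Submodule.Quotient.mk_eq_zero (coboundaries F G)).2 h

/-- The composition `gHom_LM(G, H) ⊗ gHom_LM(F, G) → gHom_LM(F, H)`. -/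
def comp : gHom G H →ₗ[k] gHom F G →ₗ[k] gHom F H :=
  (coboundaries G H).liftQ
    (LinearMap.flip <| (coboundaries F G).liftQ preComp.flip (by
      rintro ⟨f, hf⟩ ⟨f', hf'⟩
      ext g
      refine mk_eq_zero ⟨LM.comp (LM.sgn g.1) f', ?_⟩
      rw [differential_comp, differential_sgn, LinearMap.mem_ker.1 g.2, map_zero, neg_zero,
        map_zero, LinearMap.zero_apply, zero_add, LM.sgn_sgn, hf']
      rfl))
    (by
      rintro ⟨g, hg⟩ ⟨g', hg'⟩
      refine LinearMap.mem_ker.2 (LinearMap.ext fun f => ?_)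
      induction f using ind with | _ f hf
      refine mk_eq_zero ⟨LM.comp g' f, ?_⟩
      rw [differential_comp, hf, map_zero, add_zero, hg']
      rfl)

theorem comp_mk (g : LM 𝔥 G.seq H.seq) (f : LM 𝔥 F.seq G.seq) (hg : differential G H g = 0)
    (hf : differential F G f = 0) :
    comp (mk g hg) (mk f hf) = mk (LM.comp g f) (differential_comp_eq_zero hg hf) := rfl

/-- The identity of `F`. -/
def id (F : LMObj 𝔥) : gHom F F := mk (LM.id 𝔥 F.seq) differential_id

theorem comp_assoc (h : gHom H K) (g : gHom G H) (f : gHom F G) :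
    comp (comp h g) f = comp h (comp g f) := by
  induction h using ind with | _ h hh
  induction g using ind with | _ g hg
  induction f using ind with | _ f hf
  exact congrArg cls (Subtype.ext (LM.comp_assoc h g f))

theorem id_comp (f : gHom F G) : comp (id G) f = f := by
  induction f using ind with | _ f hf
  exact congrArg cls (Subtype.ext (LM.id_comp f))

theorem comp_id (f : gHom F G) : comp f (id F) = f := by
  induction f using ind with | _ f hf
  exact congrArg cls (Subtype.ext (LM.comp_id f))

end gHom

/-- The algebra `gEnd_LM(F)`; its multiplication is the composition. -/
abbrev gEnd (F : LMObj 𝔥) : Type _ := gHom F F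

instance : Ring (gEnd F) :=
  { (inferInstance : AddCommGroup (gHom F F)) with
    mul := fun g f => gHom.comp g f
    one := gHom.id F
    mul_assoc := gHom.comp_assoc
    one_mul := gHom.id_comp
    mul_one := gHom.comp_id
    left_distrib := fun g f f' => map_add (gHom.comp g) f f'
    right_distrib := fun g g' f => LinearMap.map_add₂ gHom.comp g g' f
    zero_mul := fun f => LinearMap.map_zero₂ gHom.comp f
    mul_zero := fun g => map_zero (gHom.comp g) }

instance : Algebra k (gEnd F) :=
  Algebra.ofModule (fun c g f => LinearMap.map_smul₂ gHom.comp c g f)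
    (fun c g f => map_smul (gHom.comp g) c f)

theorem gEnd_mul (g f : gEnd F) : g * f = gHom.comp g f := rfl

end Cohomology

end Category

end LeftMonodromy

end

noncomputable section

/-! Everything follows from one operator: the contraction x ⌢ (-) on `LM`, for x in V. It is an odd
derivation for composition (`LM.frown_comp`), and it anticommutes with κ (`LM.frown_kappa`) and with
the sign operator `LM.sgn` (`LM.frown_sgn`). The first holds because contraction is an odd
derivation of the exterior algebra, the second because κ is itself a sum of contractions and two
contractions anticommute, the third because contraction changes the parity of the exterior factor.

Contracting the equation δ ∘ δ + κ(δ) = 0 with x gives (x ⌢ δ) ∘ δ - δ ∘ (x ⌢ δ) - κ(x ⌢ δ) = 0.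
Since x ⌢ δ has cohomological degree 0, this says that x ⌢ δ is a cocycle (`differential_frown_δ`).
Contracting the equation d(f) = 0 in the same way gives d(x ⌢ f) = (x ⌢ δ_G) ∘ f - f ∘ (x ⌢ δ_F)
(`differential_frown`). So the class of x ⌢ δ is natural: on cohomology, composing with it after f
or before f gives the same result (`gHom.monodromy_comp`).

Naturality does the rest. Applied to f = y ⌢ δ_F, it shows that the classes for x and y commute, so
the linear map from V extends to Sym(V), uniquely because V generates. The elements of Sym(V) for
which naturality holds form a subalgebra containing V, which gives the two-sided formula for the
action (`gHom.monodromyHom_comp`). Compatibility with composition is then associativity on one side,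
and associativity with naturality on the other. The bidegrees come from δ having bidegree (1, 0) and
contraction lowering bidegree by (1, 2). -/

namespace LeftMonodromy

/-! ### Algebra maps from a symmetric algebra to a noncommutative algebra. -/

/-- The algebra homomorphism from the symmetric algebra to a not necessarily commutative algebra
induced by a linear map whose values commute with each other. -/
def symLift {R M A : Type*} [CommRing R] [AddCommGroup M] [Module R M] [Ring A] [Algebra R A]
    (f : M →ₗ[R] A) (hf : ∀ x y, Commute (f x) (f y)) : SymmetricAlgebra R M →ₐ[R] A :=
  RingCon.liftₐEquiv (TensorAlgebra.symRingCon R M) ⟨TensorAlgebra.lift R f, by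
    -- The symmetric algebra is the quotient of the tensor algebra by the congruence generated by
    -- the commutation of generators, so it is enough that the kernel congruence of the lifted map
    -- contains these generating pairs.
    refine RingCon.ringConGen_le.2 fun x y h => ?_
    induction h with | mul_comm x y
    rw [RingCon.ker_apply]
    change TensorAlgebra.lift R f _ = TensorAlgebra.lift R f _
    rw [map_mul, map_mul, TensorAlgebra.lift_ι_apply, TensorAlgebra.lift_ι_apply]
    exact hf x y⟩

theorem symLift_ι {R M A : Type*} [CommRing R] [AddCommGroup M] [Module R M] [Ring A] [Algebra R A]
    (f : M →ₗ[R] A) (hf : ∀ x y, Commute (f x) (f y)) (x : M) :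
    symLift f hf (SymmetricAlgebra.ι R M x) = f x :=
  TensorAlgebra.lift_ι_apply f x

/-- Elements of M generate the symmetric algebra, whether or not the target is commutative. This
generality is what the uniqueness of μ needs, its target being an endomorphism algebra. -/
theorem symmetricAlgebra_algHom_ext {R M A : Type*} [CommRing R] [AddCommGroup M] [Module R M]
    [Ring A] [Algebra R A] {f g : SymmetricAlgebra R M →ₐ[R] A}
    (h : ∀ x, f (SymmetricAlgebra.ι R M x) = g (SymmetricAlgebra.ι R M x)) : f = g := by
  refine AlgHom.ext fun a => ?_
  induction a using SymmetricAlgebra.induction with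
  | algebraMap c => rw [AlgHom.commutes, AlgHom.commutes]
  | ι x => exact h x
  | mul a b ha hb => rw [map_mul, map_mul, ha, hb]
  | add a b ha hb => rw [map_add, map_add, ha, hb]

/-! ### Contraction, sign involution and degree in the exterior algebra. -/

variable {B W : Type*} [Group W] {M : CoxeterMatrix B} {cs : CoxeterSystem M W}
variable {k V : Type*} [CommRing k] [AddCommGroup V] [Module k V]

theorem contract_add (x y : V) (r : Lam k V) :
    contract (x + y) r = contract x r + contract y r := by
  simp [contract]

theorem contract_smul (c : k) (x : V) (r : Lam k V) : contract (c • x) r = c • contract x r := by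
  simp [contract]

theorem contract_algebraMap (x : V) (c : k) : contract x (algebraMap k (Lam k V) c) = 0 :=
  CliffordAlgebra.contractLeft_algebraMap _ _ c

theorem contract_contract (x y : V) (r : Lam k V) :
    contract x (contract y r) = -contract y (contract x r) :=
  CliffordAlgebra.contractLeft_comm _ _ _

theorem contract_ι_mul (x : V) (m : Module.Dual k V) (r : Lam k V) :
    contract x (ExteriorAlgebra.ι k m * r) = m x • r - ExteriorAlgebra.ι k m * contract x r :=
  CliffordAlgebra.contractLeft_ι_mul _ _ _

theorem contract_eq_zero_of_mem (x : V) {r : Lam k V} (hr : r ∈ ⋀[k]^0 (Module.Dual k V)) :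
    contract x r = 0 := by
  rw [ExteriorAlgebra.exteriorPower, pow_zero, Submodule.mem_one] at hr
  obtain ⟨c, rfl⟩ := hr
  exact contract_algebraMap x c

/-- Peel a vector m off the left: the contraction of m ∧ t is m(x) t - m ∧ (x ⌢ t), and both terms
have lost one factor. Degree 0, where no factor can be lost, is covered by
`contract_eq_zero_of_mem`. -/
theorem contract_mem (x : V) (n : ℕ) {r : Lam k V} (hr : r ∈ ⋀[k]^(n + 1) (Module.Dual k V)) :
    contract x r ∈ ⋀[k]^n (Module.Dual k V) := by
  induction n generalizing r with
  | zero =>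
    rw [ExteriorAlgebra.exteriorPower, zero_add, pow_one] at hr
    obtain ⟨m, rfl⟩ := hr
    -- Writing m as m · 1 lets the derivation rule apply; the contraction of 1 vanishes and the
    -- scalar m(x) remains.
    rw [← mul_one (ExteriorAlgebra.ι k m), contract_ι_mul, ← map_one (algebraMap k (Lam k V)),
      contract_algebraMap, mul_zero, sub_zero, ExteriorAlgebra.exteriorPower, pow_zero]
    exact Submodule.smul_mem _ _ (Submodule.mem_one.2 ⟨1, rfl⟩)
  | succ n ih =>
    rw [ExteriorAlgebra.exteriorPower, pow_succ'] at hr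
    induction hr using Submodule.mul_induction_on' with
    | mem_mul_mem s hs t ht =>
      obtain ⟨m, rfl⟩ := hs
      rw [contract_ι_mul]
      refine Submodule.sub_mem _ (Submodule.smul_mem _ _ ht) ?_
      rw [ExteriorAlgebra.exteriorPower, pow_succ']
      exact Submodule.mul_mem_mul ⟨m, rfl⟩ (ih ht)
    | add s _ t _ hs ht => rw [map_add]; exact Submodule.add_mem _ hs ht

/-- The involution preserves the generating space, hence its n-th power. Integer exponents occur
because composition encodes its sign as the involution raised to the cohomological degree of the
left biequivariant factor, which may be negative. -/
theorem lamSgn_zpow_mem (i : ℤ) {n : ℕ} {r : Lam k V} (hr : r ∈ ⋀[k]^n (Module.Dual k V)) :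
    (lamSgn k V ^ i) r ∈ ⋀[k]^n (Module.Dual k V) := by
  have h : ∀ {s : Lam k V}, s ∈ ⋀[k]^n (Module.Dual k V) →
      lamSgn k V s ∈ ⋀[k]^n (Module.Dual k V) := by
    intro s hs
    have hle : (⋀[k]^n (Module.Dual k V)).map (lamSgn k V).toAlgHom.toLinearMap ≤
        ⋀[k]^n (Module.Dual k V) := by
      rw [ExteriorAlgebra.exteriorPower, Submodule.map_pow]
      refine pow_le_pow_left' ?_ n
      rintro _ ⟨_, ⟨m, rfl⟩, rfl⟩
      -- The involution negates vectors, so the image of m is the vector -m.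
      refine ⟨-m, ?_⟩
      rw [map_neg]
      exact (CliffordAlgebra.involute_ι m).symm
    exact hle ⟨s, hs, rfl⟩
  induction i using Int.induction_on with
  | zero => exact hr
  | succ i ih => rw [add_comm, zpow_add, zpow_one, AlgEquiv.mul_apply]; exact h ih
  | pred i ih =>
    -- An involution is its own inverse, so lowering the exponent also amounts to one more
    -- application.
    have e : lamSgn k V ^ (-(i : ℤ) - 1) = lamSgn k V * lamSgn k V ^ (-(i : ℤ)) := by
      have h2 : lamSgn k V * lamSgn k V = 1 := AlgEquiv.ext CliffordAlgebra.involute_involute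
      rw [sub_eq_add_neg, add_comm, zpow_add, zpow_neg_one, inv_eq_of_mul_eq_one_right h2]
    rw [e, AlgEquiv.mul_apply]
    exact h ih

variable [IsDomain k] [Module.Free k V] [Module.Finite k V]

/-! ### Contraction on left-monodromic morphisms, and bidegrees. -/

namespace LM

variable {𝔥 : Realization cs k V} {F G H : DSeq B}

theorem frown_tmul (x : V) (r : Lam k V) (f : BE 𝔥 F G) :
    frown x (r ⊗ₜ[k] f) = contract x r ⊗ₜ[k] f := rfl

theorem frown_add_left (x y : V) (f : LM 𝔥 F G) : frown (x + y) f = frown x f + frown y f := by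
  induction f using induction with
  | zero => simp
  | add f g hf hg => simp only [map_add, hf, hg]; abel
  | tmul r i j f => simp only [frown_tmul, contract_add, TensorProduct.add_tmul]

theorem frown_smul_left (c : k) (x : V) (f : LM 𝔥 F G) : frown (c • x) f = c • frown x f := by
  induction f using induction with
  | zero => simp
  | add f g hf hg => simp only [map_add, hf, hg, smul_add]
  | tmul r i j f => simp only [frown_tmul, contract_smul, TensorProduct.smul_tmul']

/-- Contraction with `x` is a derivation of odd degree with respect to the composition. -/
theorem frown_comp (x : V) (g : LM 𝔥 G H) (f : LM 𝔥 F G) :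
    frown x (comp g f) = comp (frown x g) f + comp (sgn g) (frown x f) := by
  induction g using induction with
  | zero => simp
  | add g g' ih ih' => simp only [map_add, LinearMap.add_apply, ih, ih']; abel
  | tmul r i' j' g =>
  induction f using induction with
  | zero => simp
  | add f f' ih ih' => simp only [map_add, ih, ih']; abel
  | tmul s i j f =>
  -- Two signs combine into the total cohomological degree of the left factor: `contract_mul`
  -- contributes the involution of r, and moving the contraction past the power of the involution
  -- applied to s contributes (-1)^{i'}.
  rw [sgn_tmul, map_zsmul, LinearMap.smul_apply, frown_tmul, frown_tmul, comp_tmul, comp_tmul,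
    comp_tmul, frown_tmul, contract_mul, contract_lamSgn_zpow, TensorProduct.add_tmul,
    mul_smul_comm]
  rfl

/-- In a basis, κ is a sum of contractions tensored with left multiplications. The left
multiplications act on the other tensor factor, so only the anticommutation of two contractions
matters. -/
theorem frown_kappa (x : V) (f : LM 𝔥 F G) : frown x (kappa f) = -kappa (frown x f) := by
  induction f using induction with
  | zero => simp
  | add f g hf hg => simp only [map_add, hf, hg]; abel
  | tmul r i j f =>
  rw [frown_tmul, kappa_tmul, kappa_tmul, map_sum, ← Finset.sum_neg_distrib]
  refine Finset.sum_congr rfl fun a _ => ?_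
  rw [frown_tmul, contract_contract, TensorProduct.neg_tmul]

/-- Contraction lowers the cohomological degree by one. Stating this through the sign operator
avoids any homogeneity assumption on f. -/
theorem frown_sgn (x : V) (f : LM 𝔥 F G) : frown x (sgn f) = -sgn (frown x f) := by
  induction f using induction with
  | zero => simp
  | add f g hf hg => simp only [map_add, hf, hg]; abel
  | tmul r i j f =>
  rw [sgn_tmul, map_zsmul, frown_tmul, frown_tmul, sgn_tmul, contract_lamSgn,
    TensorProduct.neg_tmul, smul_neg]

theorem frown_mem (x : V) {i j i' j' : ℤ} (hi : i' + 1 = i) (hj : j' + 2 = j) {f : LM 𝔥 F G}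
    (hf : f ∈ bideg 𝔥 F G i j) : frown x f ∈ bideg 𝔥 F G i' j' := by
  induction hf using Submodule.span_induction with
  | mem z hz =>
    obtain ⟨n, r, a, b, f, hr, h1, h2, rfl⟩ := hz
    rw [frown_tmul]
    cases n with
    -- With no exterior factor to remove, the contraction is zero and so lies in every bidegree.
    | zero =>
      rw [contract_eq_zero_of_mem x hr, TensorProduct.zero_tmul]
      exact Submodule.zero_mem _
    | succ n =>
      refine Submodule.subset_span ⟨n, _, a, b, f, contract_mem x n hr, ?_, ?_, rfl⟩ <;>
        push_cast at h1 h2 <;> omega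
  | zero => rw [map_zero]; exact Submodule.zero_mem _
  | add f g _ _ hf hg => rw [map_add]; exact Submodule.add_mem _ hf hg
  | smul c f _ hf => rw [map_smul]; exact Submodule.smul_mem _ c hf

theorem comp_mem {i j i' j' m n : ℤ} (hm : i' + i = m) (hn : j' + j = n) {g : LM 𝔥 G H}
    {f : LM 𝔥 F G} (hg : g ∈ bideg 𝔥 G H i' j') (hf : f ∈ bideg 𝔥 F G i j) :
    comp g f ∈ bideg 𝔥 F H m n := by
  induction hg using Submodule.span_induction with
  | zero => rw [map_zero]; exact Submodule.zero_mem _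
  | add g g' _ _ h h' =>
    rw [map_add, LinearMap.add_apply]; exact Submodule.add_mem _ h h'
  | smul c g _ h => rw [map_smul, LinearMap.smul_apply]; exact Submodule.smul_mem _ c h
  | mem z hz =>
  obtain ⟨p, r, a, b, g, hr, h1, h2, rfl⟩ := hz
  induction hf using Submodule.span_induction with
  | zero => rw [map_zero]; exact Submodule.zero_mem _
  | add f f' _ _ h h' => rw [map_add]; exact Submodule.add_mem _ h h'
  | smul c f _ h => rw [map_smul]; exact Submodule.smul_mem _ c h
  | mem z hz =>
  obtain ⟨q, s, a', b', f, hs, h3, h4, rfl⟩ := hz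
  rw [comp_tmul, BE.comp_of rfl rfl]
  -- The sign twist does not change the exterior degree of s, so exterior degrees add just as the
  -- biequivariant bidegrees do.
  refine Submodule.subset_span ⟨p + q, _, _, _, _, ?_, ?_, ?_, rfl⟩
  · rw [ExteriorAlgebra.exteriorPower, pow_add]
    exact Submodule.mul_mem_mul hr (lamSgn_zpow_mem a hs)
  · push_cast; omega
  · push_cast; omega

theorem id_mem : id 𝔥 F ∈ bideg 𝔥 F F 0 0 := by
  refine Submodule.subset_span ⟨0, 1, 0, 0, _, ?_, rfl, rfl, rfl⟩
  rw [ExteriorAlgebra.exteriorPower, pow_zero]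
  exact Submodule.mem_one.2 ⟨1, map_one _⟩

end LM

/-! ### Contracting the defining equation of a complex and the cocycle equation. -/

variable {𝔥 : Realization cs k V} {F G H : LMObj 𝔥}

theorem sgn_δ (F : LMObj 𝔥) : LM.sgn F.δ = -F.δ := by
  rw [LM.sgn_of_mem F.δ_mem, Int.negOnePow_one, Units.val_neg, Units.val_one, neg_smul, one_smul]

/-- This is the contraction with x of the equation δ ∘ δ + κ(δ) = 0, up to a global sign. -/
theorem differential_frown_δ (F : LMObj 𝔥) (x : V) :
    differential F F (LM.frown x F.δ) = 0 := by
  have h := congrArg (LM.frown x) F.eq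
  -- Contraction turns the odd element δ into an even one, which fixes the sign of the last term of
  -- the differential.
  have hs : LM.sgn (LM.frown x F.δ) = LM.frown x F.δ := by
    rw [← neg_inj, ← LM.frown_sgn, sgn_δ, map_neg]
  rw [map_add, LM.frown_comp, LM.frown_kappa, map_zero, sgn_δ, map_neg, LinearMap.neg_apply] at h
  rw [differential_apply, hs, ← neg_eq_zero, ← h]
  abel

/-- The contraction `x ⌢ f` is a homotopy between the two actions of `x` on a cocycle `f`. -/
theorem differential_frown (x : V) {f : LM 𝔥 F.seq G.seq} (hf : differential F G f = 0) :
    differential F G (LM.frown x f) =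
      LM.comp (LM.frown x G.δ) f - LM.comp f (LM.frown x F.δ) := by
  -- Contracting the three terms of d(f) = 0 gives -d(x ⌢ f) together with the two terms in which δ
  -- itself is contracted. The cocycle f may be inhomogeneous, since all signs are carried by
  -- `LM.sgn`; in the last term two applications of it cancel.
  have h := congrArg (LM.frown x) hf
  rw [differential_apply, map_sub, map_add, LM.frown_comp, LM.frown_comp, LM.frown_kappa, map_zero,
    sgn_δ, map_neg, LinearMap.neg_apply, LM.sgn_sgn, LM.frown_sgn, map_neg,
    LinearMap.neg_apply] at h
  rw [differential_apply, ← sub_eq_zero, ← neg_eq_zero, ← h]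
  abel

/-! ### The monodromy action on cohomology. -/

namespace gHom

/-- The class of `x ⌢ δ_F`, as a linear function of `x`. -/
def monodromy (F : LMObj 𝔥) : V →ₗ[k] gEnd F :=
  cls ∘ₗ
    { toFun := fun x => ⟨LM.frown x F.δ, differential_frown_δ F x⟩
      map_add' := fun x y => Subtype.ext (LM.frown_add_left x y F.δ)
      map_smul' := fun c x => Subtype.ext (LM.frown_smul_left c x F.δ) }

theorem monodromy_apply (F : LMObj 𝔥) (x : V) :
    monodromy F x = mk (LM.frown x F.δ) (differential_frown_δ F x) := rfl

/-- The two composites differ by the coboundary of x ⌢ f. This naturality is the source both of the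
commutativity needed to extend to Sym(V) and of the two-sided formula for the action. -/
theorem monodromy_comp (x : V) (f : gHom F G) :
    comp (monodromy G x) f = comp f (monodromy F x) := by
  induction f using ind with | _ f hf
  rw [monodromy_apply, monodromy_apply, comp_mk, comp_mk, mk_eq_mk]
  exact ⟨LM.frown x f, differential_frown x hf⟩

theorem mk_mem {f : LM 𝔥 F.seq G.seq} (hf : differential F G f = 0) {i j : ℤ}
    (h : f ∈ LM.bideg 𝔥 F.seq G.seq i j) : mk f hf ∈ bideg F G i j :=
  ⟨⟨f, hf⟩, h, rfl⟩

theorem comp_mem {i j i' j' m n : ℤ} (hm : i' + i = m) (hn : j' + j = n) {g : gHom G H}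
    {f : gHom F G} (hg : g ∈ bideg G H i' j') (hf : f ∈ bideg F G i j) :
    comp g f ∈ bideg F H m n := by
  obtain ⟨⟨g, hg'⟩, hg, rfl⟩ := hg
  obtain ⟨⟨f, hf'⟩, hf, rfl⟩ := hf
  exact mk_mem (differential_comp_eq_zero hg' hf') (LM.comp_mem hm hn hg hf)

theorem id_mem : id F ∈ bideg F F 0 0 := mk_mem differential_id LM.id_mem

/-- The differential δ has bidegree (1, 0), and contraction removes a vector of V^*, of bidegree (1,
2). -/
theorem monodromy_mem (x : V) : monodromy F x ∈ bideg F F 0 (-2) :=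
  mk_mem (differential_frown_δ F x) (LM.frown_mem x (by norm_num) (by norm_num) F.δ_mem)

/-- The left monodromy action `μ_F`. -/
def monodromyHom (F : LMObj 𝔥) : SymmetricAlgebra k V →ₐ[k] gEnd F :=
  -- Commutativity is naturality of the class for x with respect to the endomorphism given by y.
  symLift (monodromy F) fun x y => monodromy_comp x (monodromy F y)

theorem monodromyHom_ι (F : LMObj 𝔥) (x : V) :
    monodromyHom F (SymmetricAlgebra.ι k V x) = monodromy F x :=
  symLift_ι _ _ x

/-- The property holds on V by `monodromy_comp` and passes to scalars, sums and products, so it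
holds on all of Sym(V). -/
theorem monodromyHom_comp (y : SymmetricAlgebra k V) (f : gHom F G) :
    comp (monodromyHom G y) f = comp f (monodromyHom F y) := by
  induction y using SymmetricAlgebra.induction generalizing f with
  | algebraMap c =>
    rw [AlgHom.commutes, AlgHom.commutes, Algebra.algebraMap_eq_smul_one,
      Algebra.algebraMap_eq_smul_one, map_smul, map_smul, LinearMap.smul_apply]
    exact congrArg (c • ·) ((id_comp f).trans (comp_id f).symm)
  | ι x => rw [monodromyHom_ι, monodromyHom_ι, monodromy_comp]
  | mul a b ha hb =>
    -- The factors cross f one at a time, b first and then a, so their order is preserved.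
    rw [map_mul (monodromyHom G), map_mul (monodromyHom F), gEnd_mul, gEnd_mul, comp_assoc, hb,
      ← comp_assoc, ha, comp_assoc]
  | add a b ha hb => rw [map_add, map_add, map_add, map_add, LinearMap.add_apply, ha, hb]

/-- Sym^n(V) is spanned by products of n vectors, each contributing (0, -2), and composition adds
bidegrees. -/
theorem monodromyHom_mem (n : ℕ) {y : SymmetricAlgebra k V} (hy : y ∈ symDeg k V n) :
    monodromyHom F y ∈ bideg F F 0 (-2 * n) := by
  induction n generalizing y with
  | zero =>
    rw [symDeg, pow_zero, Submodule.mem_one] at hy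
    obtain ⟨c, rfl⟩ := hy
    rw [AlgHom.commutes, Algebra.algebraMap_eq_smul_one]
    exact Submodule.smul_mem _ c id_mem
  | succ n ih =>
    rw [symDeg, pow_succ] at hy
    induction hy using Submodule.mul_induction_on' with
    | mem_mul_mem s hs t ht =>
      obtain ⟨x, rfl⟩ := ht
      rw [map_mul, monodromyHom_ι, gEnd_mul]
      exact comp_mem (zero_add 0) (by push_cast; ring) (ih hs) (monodromy_mem x)
    | add s _ t _ hs ht => rw [map_add]; exact Submodule.add_mem _ hs ht

/-- Postcomposition, as an action of `gEnd_LM(G)` on `gHom_LM(F, G)`. -/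
def postcompHom (F G : LMObj 𝔥) : gEnd G →ₐ[k] Module.End k (gHom F G) :=
  AlgHom.ofLinearMap comp (LinearMap.ext id_comp) fun g g' => LinearMap.ext (comp_assoc g g')

end gHom

end LeftMonodromy

end

/-! ### The theorem. -/

theorem mainTheorem3 {B W : Type*} [Finite B] [Group W] {M : CoxeterMatrix B}
    {cs : CoxeterSystem M W} {k V : Type*} [CommRing k] [IsDomain k] [AddCommGroup V] [Module k V]
    [Module.Free k V] [Module.Finite k V] (𝔥 : LeftMonodromy.Realization cs k V) :
    ∃ (μ : ∀ F : LeftMonodromy.LMObj 𝔥, SymmetricAlgebra k V →ₐ[k] LeftMonodromy.gEnd F)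
      (star : ∀ F G : LeftMonodromy.LMObj 𝔥,
        SymmetricAlgebra k V →ₐ[k] Module.End k (LeftMonodromy.gHom F G)),
      (∀ F : LeftMonodromy.LMObj 𝔥,
        -- `μ_F` is determined by `μ_F(x) = x ⌢ δ_F`, which is a cocycle
        (∀ x : V, ∃ hx : LeftMonodromy.differential F F (LeftMonodromy.LM.frown x F.δ) = 0,
          μ F (SymmetricAlgebra.ι k V x) =
            LeftMonodromy.gHom.mk (LeftMonodromy.LM.frown x F.δ) hx) ∧
        (∀ ν : SymmetricAlgebra k V →ₐ[k] LeftMonodromy.gEnd F,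
          (∀ x : V, ∃ hx : LeftMonodromy.differential F F (LeftMonodromy.LM.frown x F.δ) = 0,
            ν (SymmetricAlgebra.ι k V x) =
              LeftMonodromy.gHom.mk (LeftMonodromy.LM.frown x F.δ) hx) → ν = μ F) ∧
        -- `μ_F` is bigraded
        (∀ n : ℕ, ∀ y ∈ LeftMonodromy.symDeg k V n,
          μ F y ∈ LeftMonodromy.gHom.bideg F F 0 (-2 * n))) ∧
      (∀ (F G : LeftMonodromy.LMObj 𝔥),
        -- the action is given by composition with `μ` on either side, and is bigraded
        (∀ (y : SymmetricAlgebra k V) (f : LeftMonodromy.gHom F G),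
          star F G y f = LeftMonodromy.gHom.comp (μ G y) f ∧
          star F G y f = LeftMonodromy.gHom.comp f (μ F y)) ∧
        (∀ n : ℕ, ∀ y ∈ LeftMonodromy.symDeg k V n, ∀ i j : ℤ,
          ∀ f ∈ LeftMonodromy.gHom.bideg F G i j,
            star F G y f ∈ LeftMonodromy.gHom.bideg F G i (j - 2 * n))) ∧
      -- the action is compatible with composition
      (∀ (F G H : LeftMonodromy.LMObj 𝔥) (y : SymmetricAlgebra k V)
        (g : LeftMonodromy.gHom G H) (f : LeftMonodromy.gHom F G),
        star F H y (LeftMonodromy.gHom.comp g f) =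
            LeftMonodromy.gHom.comp (star G H y g) f ∧
        star F H y (LeftMonodromy.gHom.comp g f) =
            LeftMonodromy.gHom.comp g (star F G y f)) := by
  have hstar : ∀ (F G : LeftMonodromy.LMObj 𝔥) (y : SymmetricAlgebra k V)
      (f : LeftMonodromy.gHom F G),
      (LeftMonodromy.gHom.postcompHom F G).comp (LeftMonodromy.gHom.monodromyHom G) y f =
        LeftMonodromy.gHom.comp (LeftMonodromy.gHom.monodromyHom G y) f := fun _ _ _ _ => rfl
  -- The action is chosen to be postcomposition with μ_G: the module axioms are then contained in
  -- its being an algebra homomorphism, the first formula holds by definition, and the second is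
  -- naturality.
  refine ⟨LeftMonodromy.gHom.monodromyHom, fun F G =>
    (LeftMonodromy.gHom.postcompHom F G).comp (LeftMonodromy.gHom.monodromyHom G),
    fun F => ⟨fun x => ⟨LeftMonodromy.differential_frown_δ F x,
      LeftMonodromy.gHom.monodromyHom_ι F x⟩, fun ν hν => ?_,
      fun n y hy => LeftMonodromy.gHom.monodromyHom_mem n hy⟩,
    fun F G => ⟨fun y f => ⟨rfl, LeftMonodromy.gHom.monodromyHom_comp y f⟩,
      fun n y hy i j f hf => ?_⟩, fun F G H y g f => ⟨?_, ?_⟩⟩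
  · refine LeftMonodromy.symmetricAlgebra_algHom_ext fun x => ?_
    obtain ⟨_, h⟩ := hν x
    rw [h, LeftMonodromy.gHom.monodromyHom_ι]
    rfl
  · rw [hstar]
    exact LeftMonodromy.gHom.comp_mem (zero_add i) (by ring)
      (LeftMonodromy.gHom.monodromyHom_mem n hy) hf
  -- Moving y onto the outer factor g is associativity alone; for the inner factor f, in the next
  -- case, μ must also be moved across g by naturality.
  · rw [hstar, hstar, LeftMonodromy.gHom.comp_assoc]
  · rw [hstar, hstar, ← LeftMonodromy.gHom.comp_assoc,
      LeftMonodromy.gHom.monodromyHom_comp y g, LeftMonodromy.gHom.comp_assoc]
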